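/- Let $G$ be a finite group, let $k$ be an algebraically closed field whose characteristic does not divide $|G|$, and let $n\ge 1$. Let $\Sigma_n^G$ be the monoid of ordered $G$-partitions $((P_1,g_1),\dots,(P_r,g_r))$ of $[n]=\{1,\dots,n\}$, where $P_1,\dots,P_r$ are the distinct blocks of a set partition of $[n]$ and $g_1,\dots,g_r\in G$; the product of $((P_1,g_1),\dots,(P_r,g_r))$ and $((Q_1,h_1),\dots,(Q_s,h_s))$ is the sequence of all $(P_i\cap Q_j,\,g_ih_j)$, ordered lexicographically by $(i,j)$, with empty intersections omitted. The quiver of the algebra $k\Sigma_n^G$ has as vertices the simple left $k\Sigma_n^G$-modules up to isomorphism, and it has $\dim_k \mathrm{Ext}^1_{k\Sigma_n^G}(S,T)$ arrows from $S$ to $T$. Let $\mathrm{Irr}\,G$ be the set of simple left $kG$-modules up to isomorphism. An $\mathrm{Irr}\,G$-labelled set partition of $[n]$ is a set $P=\{(P_1,V_1),\dots,(P_r,V_r)\}$, where $P_1,\dots,P_r$ are the distinct blocks of a set partition of $[n]$ and $V_1,\dots,V_r\in\mathrm{Irr}\,G$. For such a $P$ let $S_P$ be the $k\Sigma_n^G$-module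 with underlying space $V_1\otimes_k\cdots\otimes_k V_r$ on which $\sigma=((Q_1,h_1),\dots,(Q_s,h_s))$ acts as follows: if every $P_i$ is contained in a block $Q_{j(i)}$ of $\sigma$, then $\sigma(v_1\otimes\cdots\otimes v_r)=h_{j(1)}v_1\otimes\cdots\otimes h_{j(r)}v_r$; otherwise $\sigma$ acts as zero. Then $P\mapsto S_P$ is a bijection from the set of $\mathrm{Irr}\,G$-labelled set partitions of $[n]$ onto the vertex set of the quiver of $k\Sigma_n^G$. Under this identification the arrows are as follows. For every $\mathrm{Irr}\,G$-labelled set partition $P=\{(P_1,V_1),\dots,(P_r,V_r)\}$, all $i\ne j$ in $\{1,\dots,r\}$ and every $U\in\mathrm{Irr}\,G$, there are exactly $\dim_k\mathrm{Hom}_{kG}(U,V_i\otimes_k V_j)$ arrows from $P$ to $$\{(P_i\cup P_j,U)\}\cup\bigl(P\setminus\{(P_i,V_i),(P_j,V_j)\}\bigr),$$ where $G$ acts diagonally on $V_i\otimes_k V_j$. There are no arrows between two labelled set partitions other than these. -/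

import Mathlib

open CategoryTheory
open scoped TensorProduct

universe u v w

/-! ### Simple modules and the Gabriel quiver of an algebra -/

section Quiver

/-- Isomorphism of simple left `A`-modules. -/
def simpleModuleSetoid (A : Type w) [Ring A] :
    Setoid {M : ModuleCat.{w} A // IsSimpleModule A M} where
  r M N := Nonempty (M.1 ≃ₗ[A] N.1)
  iseqv :=
    ⟨fun _ => ⟨LinearEquiv.refl _ _⟩, fun ⟨e⟩ => ⟨e.symm⟩, fun ⟨e⟩ ⟨f⟩ => ⟨e.trans f⟩⟩

/-- The set of simple left `A`-modules, taken up to isomorphism. Every simple module is a quotient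
of `A`, so nothing is lost by taking modules in the universe of `A`. -/
def SimpleClass (A : Type w) [Ring A] : Type (w + 1) :=
  Quotient (simpleModuleSetoid A)

/-- A simple module in the given isomorphism class. -/
noncomputable def SimpleClass.rep {A : Type w} [Ring A] (S : SimpleClass A) : ModuleCat.{w} A :=
  (Quotient.out S).1

/-- The Gabriel quiver of a `k`-algebra `A`: its vertices are the elements of `SimpleClass A`, and
the number of arrows from `S` to `T` is `dim_k Ext¹_A(S, T)`, for left modules. -/
noncomputable def gabrielArrows (k : Type u) [Field k] (A : Type w) [Ring A] [Algebra k A]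
    (S T : SimpleClass A) : Cardinal.{w} :=
  Module.rank k (Abelian.Ext.{w} S.rep T.rep 1)

variable (k : Type u) [Field k] (G : Type v) [Group G]

/-- `Irr G`: the set of simple left `kG`-modules, up to isomorphism. -/
abbrev Irr : Type (max u v + 1) := SimpleClass (MonoidAlgebra k G)

variable {k G}

/-- The underlying `k`-vector space of a simple `kG`-module. -/
abbrev Irr.Space (V : Irr k G) : Type (max u v) :=
  RestrictScalars k (MonoidAlgebra k G) (SimpleClass.rep V)

/-- The action of `G` on a simple `kG`-module. -/
noncomputable abbrev Irr.action (V : Irr k G) : Representation k G (Irr.Space V) :=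
  Representation.ofModule (SimpleClass.rep V)

/-- `dim_k Hom_{kG}(U, V ⊗ W)`, where `G` acts diagonally on `V ⊗ W`. -/
noncomputable def dimHomTensor (U V W : Irr k G) : Cardinal.{max u v} :=
  Module.rank k
    ((Irr.action U).IntertwiningMap ((Irr.action V).tprod (Irr.action W)))

end Quiver

/-! ### The monoid of ordered `G`-partitions -/

/-- An ordered `G`-partition `((P₁, g₁), …, (P_r, g_r))` of the `n`-element set: the `P_i` are
nonempty, pairwise disjoint, and they cover the set. -/
@[ext]
structure OrderedGPartition (n : ℕ) (G : Type v) : Type v where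
  parts : List (Finset (Fin n) × G)
  nonempty : ∀ p ∈ parts, p.1.Nonempty
  disjoint : parts.Pairwise fun p q => Disjoint p.1 q.1
  cover : ∀ x : Fin n, ∃ p ∈ parts, x ∈ p.1

namespace OrderedGPartition

variable {n : ℕ} {G : Type v}

/-- The sequence of all `(P_i ∩ Q_j, g_i h_j)`, in lexicographic order of `(i, j)`, where empty
intersections are omitted. -/
def mulParts [Mul G] (l m : List (Finset (Fin n) × G)) : List (Finset (Fin n) × G) :=
  ((l.product m).map fun x => (x.1.1 ∩ x.2.1, x.1.2 * x.2.2)).filter fun p => p.1.Nonempty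

theorem mem_mulParts [Mul G] {l m : List (Finset (Fin n) × G)} {p : Finset (Fin n) × G} :
    p ∈ mulParts l m ↔
      ∃ a ∈ l, ∃ b ∈ m, (a.1 ∩ b.1, a.2 * b.2) = p ∧ p.1.Nonempty := by
  simp only [mulParts, List.mem_filter, List.mem_map, List.pair_mem_product, Prod.exists,
    decide_eq_true_eq]
  constructor
  · rintro ⟨⟨a, b, c, d, ⟨h1, h2⟩, rfl⟩, h⟩
    exact ⟨a, b, h1, c, d, h2, rfl, h⟩
  · rintro ⟨a, b, h1, c, d, h2, rfl, h⟩
    exact ⟨⟨a, b, c, d, ⟨h1, h2⟩, rfl⟩, h⟩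

theorem mulParts_nil [Mul G] (m : List (Finset (Fin n) × G)) : mulParts [] m = [] := rfl

theorem mulParts_cons [Mul G] (p : Finset (Fin n) × G) (l m : List (Finset (Fin n) × G)) :
    mulParts (p :: l) m =
      ((m.map fun q => (p.1 ∩ q.1, p.2 * q.2)).filter fun r => r.1.Nonempty) ++
        mulParts l m := by
  simp [mulParts, List.product, Function.comp_def]

theorem mulParts_append [Mul G] (l l' m : List (Finset (Fin n) × G)) :
    mulParts (l ++ l') m = mulParts l m ++ mulParts l' m := by
  induction l with
  | nil => rfl
  | cons p l ih => simp [mulParts_cons, ih]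

theorem pairwise_mulParts [Mul G] {l m : List (Finset (Fin n) × G)}
    (hl : l.Pairwise fun p q => Disjoint p.1 q.1) (hm : m.Pairwise fun p q => Disjoint p.1 q.1) :
    (mulParts l m).Pairwise fun p q => Disjoint p.1 q.1 := by
  induction l with
  | nil => simp [mulParts_nil]
  | cons a l ih =>
    rw [List.pairwise_cons] at hl
    rw [mulParts_cons, List.pairwise_append]
    refine ⟨?_, ih hl.2, ?_⟩
    · refine List.Pairwise.filter _ (List.Pairwise.map _ ?_ hm)
      intro p q h
      exact Finset.disjoint_of_subset_left Finset.inter_subset_right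
        (Finset.disjoint_of_subset_right Finset.inter_subset_right h)
    · intro p hp q hq
      simp only [List.mem_filter, List.mem_map] at hp
      obtain ⟨⟨b, _, rfl⟩, -⟩ := hp
      obtain ⟨c, hc, d, _, rfl, -⟩ := mem_mulParts.1 hq
      exact Finset.disjoint_of_subset_left Finset.inter_subset_left
        (Finset.disjoint_of_subset_right Finset.inter_subset_left (hl.1 c hc))

theorem mulParts_assoc [Semigroup G] (l m r : List (Finset (Fin n) × G)) :
    mulParts (mulParts l m) r = mulParts l (mulParts m r) := by
  induction l with
  | nil => rfl
  | cons p l ih =>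
    rw [mulParts_cons p l m, mulParts_append, ih, mulParts_cons p l]
    congr 1
    clear ih
    induction m with
    | nil => rfl
    | cons q m ihm =>
      rw [mulParts_cons q m r, List.map_append, List.filter_append, ← ihm, List.map_cons,
        List.filter_cons]
      split_ifs with h
      · rw [mulParts_cons]
        congr 1
        simp only [List.filter_map, List.map_map, List.filter_filter]
        have : ∀ t : Finset (Fin n) × G, ((p.1 ∩ q.1) ∩ t.1).Nonempty →
            (q.1 ∩ t.1).Nonempty := fun t ht =>
          ht.mono (by rw [Finset.inter_assoc]; exact Finset.inter_subset_right)
        rw [show ((fun q => (p.1 ∩ q.1, p.2 * q.2)) ∘ fun t : Finset (Fin n) × G =>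
            (q.1 ∩ t.1, q.2 * t.2)) = fun t : Finset (Fin n) × G =>
            ((p.1 ∩ q.1) ∩ t.1, (p.2 * q.2) * t.2) from by
          funext t; simp [Finset.inter_assoc, mul_assoc]]
        congr 1
        apply List.filter_congr
        intro t _
        have ht := this t
        simp only [Function.comp, Finset.inter_assoc] at ht ⊢
        by_cases h1 : (p.1 ∩ (q.1 ∩ t.1)).Nonempty
        · simp [h1, ht h1]
        · simp [h1]
      · symm
        rw [List.append_left_eq_self]
        simp only [List.filter_eq_nil_iff, List.mem_map, List.mem_filter]
        rintro _ ⟨_, ⟨⟨t, _, rfl⟩, _⟩, rfl⟩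
        simp only [decide_eq_true_eq] at h ⊢
        intro h'
        exact h (h'.mono (by rw [← Finset.inter_assoc]; exact Finset.inter_subset_left))

instance [Mul G] : Mul (OrderedGPartition n G) where
  mul σ τ :=
    { parts := mulParts σ.parts τ.parts
      nonempty := fun _ hp => by
        obtain ⟨_, _, _, _, _, h⟩ := mem_mulParts.1 hp
        exact h
      disjoint := pairwise_mulParts σ.disjoint τ.disjoint
      cover := fun x => by
        obtain ⟨a, ha, hxa⟩ := σ.cover x
        obtain ⟨b, hb, hxb⟩ := τ.cover x
        have hx : x ∈ a.1 ∩ b.1 := Finset.mem_inter.2 ⟨hxa, hxb⟩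
        exact ⟨_, mem_mulParts.2 ⟨a, ha, b, hb, rfl, ⟨x, hx⟩⟩, hx⟩ }

theorem mul_parts [Mul G] (σ τ : OrderedGPartition n G) :
    (σ * τ).parts = mulParts σ.parts τ.parts := rfl

/-- The identity element is `((the whole set, 1))`. -/
instance [One G] [NeZero n] : One (OrderedGPartition n G) where
  one :=
    { parts := [(Finset.univ, 1)]
      nonempty := by simp [Finset.univ_nonempty]
      disjoint := by simp
      cover := by simp }

theorem one_parts [One G] [NeZero n] :
    (1 : OrderedGPartition n G).parts = [(Finset.univ, 1)] := rfl

instance [Monoid G] [NeZero n] : Monoid (OrderedGPartition n G) where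
  mul_assoc σ τ ρ := OrderedGPartition.ext (mulParts_assoc _ _ _)
  one_mul σ := OrderedGPartition.ext <| by
    rw [mul_parts, one_parts, mulParts_cons, mulParts_nil]
    simpa using σ.nonempty
  mul_one σ := OrderedGPartition.ext <| by
    rw [mul_parts, one_parts]
    have h := σ.nonempty
    generalize σ.parts = l at h ⊢
    induction l with
    | nil => rfl
    | cons p l ih =>
      rw [mulParts_cons, ih fun q hq => h q (List.mem_cons_of_mem _ hq)]
      simp [h p List.mem_cons_self]

/-- Two parts of an ordered `G`-partition which share a point are equal. -/
theorem eq_of_mem (σ : OrderedGPartition n G) {p q : Finset (Fin n) × G} (hp : p ∈ σ.parts)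
    (hq : q ∈ σ.parts) {x : Fin n} (hxp : x ∈ p.1) (hxq : x ∈ q.1) : p = q := by
  by_contra hne
  have : Std.Symm fun p q : Finset (Fin n) × G => Disjoint p.1 q.1 := ⟨fun _ _ h => h.symm⟩
  exact Finset.disjoint_left.1 (σ.disjoint.forall hp hq hne) hxp hxq

end OrderedGPartition

/-! ### Labelled set partitions -/

/-- An `X`-labelled set partition `{(P₁, x₁), …, (P_r, x_r)}` of the `n`-element set. -/
@[ext]
structure LabelledSetPartition (n : ℕ) (X : Type w) : Type w where
  carrier : Set (Finset (Fin n) × X)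
  nonempty : ∀ p ∈ carrier, p.1.Nonempty
  disjoint : ∀ p ∈ carrier, ∀ q ∈ carrier, p ≠ q → Disjoint p.1 q.1
  cover : ∀ x : Fin n, ∃ p ∈ carrier, x ∈ p.1

namespace LabelledSetPartition

variable {n : ℕ} {X : Type w}

/-- The blocks of a labelled set partition. -/
def Block (P : LabelledSetPartition n X) : Type :=
  {B : Finset (Fin n) // ∃ x, (B, x) ∈ P.carrier}

/-- The label of a block. -/
noncomputable def label (P : LabelledSetPartition n X) (B : P.Block) : X := B.2.choose

theorem label_mem (P : LabelledSetPartition n X) (B : P.Block) :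
    (B.1, P.label B) ∈ P.carrier := B.2.choose_spec

theorem label_eq (P : LabelledSetPartition n X) (B : P.Block) {x : X}
    (h : (B.1, x) ∈ P.carrier) : P.label B = x := by
  by_contra hne
  have hd := P.disjoint _ (P.label_mem B) _ h (fun e => hne (congrArg Prod.snd e))
  exact (P.nonempty _ h).ne_empty (disjoint_self.1 hd)

/-- The labelled set partition `{(B ∪ C, U)} ∪ P \ {(B, x_B), (C, x_C)}`, for two different blocks
`B` and `C` of `P`. -/
noncomputable def merge (P : LabelledSetPartition n X) (B C : P.Block) (_hBC : B ≠ C) (U : X) :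
    LabelledSetPartition n X where
  carrier := {(B.1 ∪ C.1, U)} ∪ (P.carrier \ {(B.1, P.label B), (C.1, P.label C)})
  nonempty := by
    rintro p (rfl | hp)
    · exact (P.nonempty _ (P.label_mem B)).mono Finset.subset_union_left
    · exact P.nonempty _ hp.1
  disjoint := by
    have key : ∀ p ∈ P.carrier \ {(B.1, P.label B), (C.1, P.label C)},
        Disjoint p.1 (B.1 ∪ C.1) := by
      rintro p ⟨hp, hne⟩
      simp only [Set.mem_insert_iff, Set.mem_singleton_iff, not_or] at hne
      exact Finset.disjoint_union_right.2
        ⟨P.disjoint _ hp _ (P.label_mem B) hne.1, P.disjoint _ hp _ (P.label_mem C) hne.2⟩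
    rintro p (rfl | hp) q (rfl | hq) hne
    · exact absurd rfl hne
    · exact (key q hq).symm
    · exact key p hp
    · exact P.disjoint _ hp.1 _ hq.1 hne
  cover := by
    intro x
    obtain ⟨p, hp, hx⟩ := P.cover x
    by_cases h : p ∈ ({(B.1, P.label B), (C.1, P.label C)} : Set (Finset (Fin n) × X))
    · refine ⟨_, Or.inl rfl, ?_⟩
      simp only [Set.mem_insert_iff, Set.mem_singleton_iff] at h
      rcases h with rfl | rfl
      · exact Finset.mem_union_left _ hx
      · exact Finset.mem_union_right _ hx
    · exact ⟨p, Or.inr ⟨hp, h⟩, hx⟩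

end LabelledSetPartition

/-! ### The simple module attached to a labelled set partition -/

namespace LabelledSetPartition

variable {n : ℕ} {G : Type v}

/-- Every block of `P` lies in a block of `σ`: in the refinement order, the set partition which
underlies `P` is below the one which underlies `σ`. -/
def Refines {X : Type w} (P : LabelledSetPartition n X) (σ : OrderedGPartition n G) : Prop :=
  ∀ B : P.Block, ∃ q ∈ σ.parts, B.1 ⊆ q.1

/-- If `P` refines `σ`, the element of `G` that `σ` attaches to its block containing `B`. -/
noncomputable def Refines.value {X : Type w} {P : LabelledSetPartition n X}
    {σ : OrderedGPartition n G} (h : P.Refines σ) (B : P.Block) : G :=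
  (h B).choose.2

section

variable {X : Type w} {P : LabelledSetPartition n X} {σ τ : OrderedGPartition n G}

theorem Refines.value_eq (h : P.Refines σ) (B : P.Block) {q : Finset (Fin n) × G}
    (hq : q ∈ σ.parts) (hB : B.1 ⊆ q.1) : h.value B = q.2 := by
  obtain ⟨x, hx⟩ := P.nonempty _ (P.label_mem B)
  exact congrArg Prod.snd
    (σ.eq_of_mem (h B).choose_spec.1 hq ((h B).choose_spec.2 hx) (hB hx))

theorem refines_mul [Group G] : P.Refines (σ * τ) ↔ P.Refines σ ∧ P.Refines τ := by
  constructor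
  · intro h
    constructor <;> intro B
    · obtain ⟨_, hq, hB⟩ := h B
      obtain ⟨a, ha, b, hb, rfl, -⟩ := OrderedGPartition.mem_mulParts.1 hq
      exact ⟨a, ha, hB.trans Finset.inter_subset_left⟩
    · obtain ⟨_, hq, hB⟩ := h B
      obtain ⟨a, ha, b, hb, rfl, -⟩ := OrderedGPartition.mem_mulParts.1 hq
      exact ⟨b, hb, hB.trans Finset.inter_subset_right⟩
  · rintro ⟨h, h'⟩ B
    obtain ⟨a, ha, hBa⟩ := h B
    obtain ⟨b, hb, hBb⟩ := h' B
    have hB := Finset.subset_inter hBa hBb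
    exact ⟨_, OrderedGPartition.mem_mulParts.2
      ⟨a, ha, b, hb, rfl, (P.nonempty _ (P.label_mem B)).mono hB⟩, hB⟩

theorem Refines.value_mul [Group G] (h : P.Refines (σ * τ)) (hσ : P.Refines σ) (hτ : P.Refines τ)
    (B : P.Block) : h.value B = hσ.value B * hτ.value B := by
  have hB := Finset.subset_inter (hσ B).choose_spec.2 (hτ B).choose_spec.2
  exact h.value_eq B (OrderedGPartition.mem_mulParts.2
    ⟨_, (hσ B).choose_spec.1, _, (hτ B).choose_spec.1, rfl,
      (P.nonempty _ (P.label_mem B)).mono hB⟩) hB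

theorem refines_one [Group G] [NeZero n] : P.Refines (1 : OrderedGPartition n G) :=
  fun B => ⟨(Finset.univ, 1), by simp [OrderedGPartition.one_parts], Finset.subset_univ _⟩

theorem Refines.value_one [Group G] [NeZero n] (h : P.Refines (1 : OrderedGPartition n G)) (B : P.Block) :
    h.value B = 1 :=
  h.value_eq B (q := (Finset.univ, 1)) (by simp [OrderedGPartition.one_parts])
    (Finset.subset_univ _)

end

variable {k : Type u} [Field k] [Group G]

/-- The vector space `V₁ ⊗ ⋯ ⊗ V_r` for `P = {(P₁, V₁), …, (P_r, V_r)}`. -/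
abbrev Space (P : LabelledSetPartition n (Irr k G)) : Type (max u v) :=
  PiTensorProduct k fun B : P.Block => Irr.Space (P.label B)

open scoped Classical in
/-- The simple module of the monoid of ordered `G`-partitions which belongs to
`P = {(P₁, V₁), …, (P_r, V_r)}`, on the space `V₁ ⊗ ⋯ ⊗ V_r`. If each `P_i` lies in a block of `σ`
and `σ` attaches `g_i` to that block, then `σ (v₁ ⊗ ⋯ ⊗ v_r) = g₁ v₁ ⊗ ⋯ ⊗ g_r v_r`; every other
`σ` acts as zero. So the elements of the `J`-class of `{P₁, …, P_r}` act through
`((P_{i₁}, g_{i₁}), …) ↦ (g₁, …, g_r)`, and those not above this `J`-class act as zero. -/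
noncomputable def action [NeZero n] (P : LabelledSetPartition n (Irr k G)) :
    Representation k (OrderedGPartition n G) P.Space where
  toFun σ :=
    if h : P.Refines σ then
      PiTensorProduct.map fun B => Irr.action (P.label B) (h.value B)
    else 0
  map_one' := by
    rw [dif_pos refines_one]
    simp only [Refines.value_one, map_one]
    exact PiTensorProduct.map_one
  map_mul' σ τ := by
    by_cases h : P.Refines (σ * τ)
    · obtain ⟨hσ, hτ⟩ := refines_mul.1 h
      rw [dif_pos h, dif_pos hσ, dif_pos hτ]
      simp only [Refines.value_mul h hσ hτ, map_mul]
      exact PiTensorProduct.map_mul _ _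
    · rw [dif_neg h]
      by_cases hσ : P.Refines σ
      · have hτ : ¬ P.Refines τ := fun hτ => h (refines_mul.2 ⟨hσ, hτ⟩)
        rw [dif_neg hτ, mul_zero]
      · rw [dif_neg hσ, zero_mul]

end LabelledSetPartition

/-!
Let `ε` run through the ordered set partitions, the elements of `Σ_n^G` with all labels `1`. They
are idempotent, and on a simple module there is a finest set partition whose orderings `ε` act as
the identity, while every `σ` which it does not refine acts as zero. The module is then a simple
module of the power of `G` by the blocks, hence an outer tensor product of simple `kG`-modules.

`Ext¹(S_P, S_Q)` consists of the cocycles `Σ_n^G → Hom_k(S_P, S_Q)` modulo coboundaries. Averaging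
over powers of `G` and commuting idempotents show that every cocycle is a coboundary unless `Q` has
the blocks of `P` with two of them, `B` and `C`, merged. In that case the class of a cocycle is
determined by the difference of its values at an ordering of `P` with `B` before `C` and at one with
`C` before `B`. This difference may be any map `S_P → S_Q` which commutes with the power of `G` by
the blocks of `Q`, acting diagonally on the factors of `B` and `C`. Such maps vanish unless the
labels of the other blocks agree; after splitting these off they are the maps `V_B ⊗ V_C → U`, and
by semisimplicity of `kG` there are as many as maps `U → V_B ⊗ V_C`.
-/

/-! ### Ordered `G`-partitions as weak orders with labels -/

namespace OrderedGPartition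

variable {n : ℕ} {G : Type v} (σ τ : OrderedGPartition n G) {x y z : Fin n}

/-- The index in `σ` of the block containing `x`. Only the weak order which the ranks define is
ever used; together with the labels it determines `σ`. -/
def rank (x : Fin n) : ℕ := σ.parts.findIdx fun p => x ∈ p.1

/-- The label of the block of `σ` containing `x`. -/
noncomputable def labelAt (x : Fin n) : G := (σ.cover x).choose.2

theorem labelAt_eq {p : Finset (Fin n) × G} (hp : p ∈ σ.parts) (hx : x ∈ p.1) :
    σ.labelAt x = p.2 :=
  congrArg Prod.snd (σ.eq_of_mem (σ.cover x).choose_spec.1 hp (σ.cover x).choose_spec.2 hx)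

theorem rank_lt_length (x : Fin n) : σ.rank x < σ.parts.length := by
  simpa [rank, List.findIdx_lt_length] using σ.cover x

theorem mem_getElem_rank (x : Fin n) : x ∈ (σ.parts[σ.rank x]'(σ.rank_lt_length x)).1 := by
  simpa only [decide_eq_true_eq] using! List.findIdx_getElem (w := σ.rank_lt_length x)

theorem nodup_parts : σ.parts.Nodup :=
  σ.disjoint.imp_of_mem fun {p q} hp _ hpq hne => by
    subst hne
    exact (σ.nonempty p hp).ne_empty (disjoint_self.1 hpq)

theorem rank_eq_of_mem {i : ℕ} (hi : i < σ.parts.length) (hx : x ∈ σ.parts[i].1) :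
    σ.rank x = i :=
  (σ.nodup_parts.getElem_inj_iff).1 <|
    σ.eq_of_mem (List.getElem_mem _) (List.getElem_mem _) (σ.mem_getElem_rank x) hx

theorem rank_eq_rank_iff : σ.rank x = σ.rank y ↔ ∃ p ∈ σ.parts, x ∈ p.1 ∧ y ∈ p.1 := by
  constructor
  · intro h
    refine ⟨_, List.getElem_mem (σ.rank_lt_length x), σ.mem_getElem_rank x, ?_⟩
    simpa only [h] using σ.mem_getElem_rank y
  · rintro ⟨p, hp, hx, hy⟩
    obtain ⟨i, hi, rfl⟩ := List.getElem_of_mem hp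
    rw [σ.rank_eq_of_mem hi hx, σ.rank_eq_of_mem hi hy]

/-- The blocks of `σ` are the level sets of `f`, in increasing order of the value of `f`. -/
structure SortedBy {α : Type*} [LinearOrder α] (f : Fin n → α) : Prop where
  lt : σ.parts.Pairwise fun p q => ∀ x ∈ p.1, ∀ y ∈ q.1, f x < f y
  eq : ∀ p ∈ σ.parts, ∀ x ∈ p.1, ∀ y ∈ p.1, f x = f y

namespace SortedBy

variable {σ} {α : Type*} [LinearOrder α] {f : Fin n → α}

theorem eq_of_rank_eq (h : σ.SortedBy f) (hxy : σ.rank x = σ.rank y) : f x = f y := by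
  obtain ⟨p, hp, hx, hy⟩ := σ.rank_eq_rank_iff.1 hxy
  exact h.eq p hp x hx y hy

theorem lt_of_rank_lt (h : σ.SortedBy f) (hxy : σ.rank x < σ.rank y) : f x < f y :=
  List.pairwise_iff_getElem.1 h.lt _ _ _ _ hxy x (σ.mem_getElem_rank x) y (σ.mem_getElem_rank y)

theorem rank_lt_iff (h : σ.SortedBy f) : σ.rank x < σ.rank y ↔ f x < f y := by
  refine ⟨h.lt_of_rank_lt, fun hxy => ?_⟩
  contrapose! hxy
  rcases hxy.lt_or_eq with hlt | heq
  · exact (h.lt_of_rank_lt hlt).le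
  · exact (h.eq_of_rank_eq heq).le

theorem rank_eq_iff (h : σ.SortedBy f) : σ.rank x = σ.rank y ↔ f x = f y := by
  simp only [eq_iff_le_not_lt, ← not_lt, h.rank_lt_iff]

end SortedBy

theorem sortedBy_rank : σ.SortedBy σ.rank where
  lt := List.pairwise_iff_getElem.2 fun i j hi hj hij x hx y hy => by
    rwa [σ.rank_eq_of_mem hi hx, σ.rank_eq_of_mem hj hy]
  eq _ hp _ hx _ hy := σ.rank_eq_rank_iff.2 ⟨_, hp, hx, hy⟩

theorem mem_parts_iff {p : Finset (Fin n) × G} :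
    p ∈ σ.parts ↔ ∃ x, p = (Finset.univ.filter fun y => σ.rank y = σ.rank x, σ.labelAt x) := by
  have key {q : Finset (Fin n) × G} (hq : q ∈ σ.parts) {x : Fin n} (hx : x ∈ q.1) :
      q = (Finset.univ.filter fun y => σ.rank y = σ.rank x, σ.labelAt x) := by
    refine Prod.ext (Finset.ext fun y => ?_) (σ.labelAt_eq hq hx).symm
    simp only [Finset.mem_filter_univ, rank_eq_rank_iff]
    refine ⟨fun hy => ⟨q, hq, hy, hx⟩, ?_⟩
    rintro ⟨r, hr, hyr, hxr⟩
    rwa [σ.eq_of_mem hq hr hx hxr]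
  constructor
  · intro hp
    obtain ⟨x, hx⟩ := σ.nonempty p hp
    exact ⟨x, key hp hx⟩
  · rintro ⟨x, rfl⟩
    obtain ⟨q, hq, hx⟩ := σ.cover x
    rwa [← key hq hx]

variable {σ τ} in
theorem ext_rank (hrank : ∀ x y, σ.rank x < σ.rank y ↔ τ.rank x < τ.rank y)
    (hlabel : ∀ x, σ.labelAt x = τ.labelAt x) : σ = τ := by
  have heq (x y : Fin n) : σ.rank x = σ.rank y ↔ τ.rank x = τ.rank y := by
    simp only [eq_iff_le_not_lt, ← not_lt, hrank]
  have hperm : σ.parts.Perm τ.parts := by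
    refine (List.perm_ext_iff_of_nodup σ.nodup_parts τ.nodup_parts).2 fun p => ?_
    simp only [mem_parts_iff, heq, hlabel]
  refine OrderedGPartition.ext (hperm.eq_of_pairwise (fun p q hp _ hpq hqp => ?_)
    σ.sortedBy_rank.lt (τ.sortedBy_rank.lt.imp fun h x hx y hy => (hrank x y).2 (h x hx y hy)))
  obtain ⟨x, hx⟩ := σ.nonempty p hp
  obtain ⟨y, hy⟩ := τ.nonempty q ‹_›
  exact absurd (hpq x hx y hy) (hqp y hy x hx).asymm

instance [Finite G] : Finite (OrderedGPartition n G) := by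
  refine Finite.of_injective (fun σ : OrderedGPartition n G =>
    ((fun x y => σ.rank x < σ.rank y : Fin n → Fin n → Prop), σ.labelAt)) fun σ τ h => ?_
  obtain ⟨hrank, hlabel⟩ := Prod.mk.inj h
  exact ext_rank (fun x y => iff_of_eq (congrFun₂ hrank x y)) (congrFun hlabel)

section Mul

variable [Mul G]

theorem sortedBy_mul : (σ * τ).SortedBy fun x => toLex (σ.rank x, τ.rank x) where
  lt := by
    refine List.Pairwise.filter _ (List.pairwise_map.2 (List.pairwise_flatMap.2 ⟨?_, ?_⟩))
    · refine fun p hp => List.pairwise_map.2 (τ.sortedBy_rank.lt.imp fun h x hx y hy => ?_)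
      rw [Finset.mem_inter] at hx hy
      exact Prod.Lex.toLex_lt_toLex.2
        (Or.inr ⟨σ.sortedBy_rank.eq p hp x hx.1 y hy.1, h x hx.2 y hy.2⟩)
    · refine σ.sortedBy_rank.lt.imp fun h a ha b hb x hx y hy => ?_
      obtain ⟨_, -, rfl⟩ := List.mem_map.1 ha
      obtain ⟨_, -, rfl⟩ := List.mem_map.1 hb
      exact Prod.Lex.toLex_lt_toLex.2
        (Or.inl (h x (Finset.mem_inter.1 hx).1 y (Finset.mem_inter.1 hy).1))
  eq p hp x hx y hy := by
    obtain ⟨a, ha, b, hb, rfl, -⟩ := mem_mulParts.1 hp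
    rw [Finset.mem_inter] at hx hy
    rw [σ.sortedBy_rank.eq a ha x hx.1 y hy.1, τ.sortedBy_rank.eq b hb x hx.2 y hy.2]

theorem rank_mul_lt_iff : (σ * τ).rank x < (σ * τ).rank y ↔
    σ.rank x < σ.rank y ∨ σ.rank x = σ.rank y ∧ τ.rank x < τ.rank y :=
  (sortedBy_mul σ τ).rank_lt_iff.trans Prod.Lex.toLex_lt_toLex

theorem rank_mul_eq_iff :
    (σ * τ).rank x = (σ * τ).rank y ↔ σ.rank x = σ.rank y ∧ τ.rank x = τ.rank y := by
  simp only [(sortedBy_mul σ τ).rank_eq_iff, EmbeddingLike.apply_eq_iff_eq, Prod.mk.injEq]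

@[simp]
theorem labelAt_mul (x : Fin n) : (σ * τ).labelAt x = σ.labelAt x * τ.labelAt x := by
  obtain ⟨p, hp, hx⟩ := (σ * τ).cover x
  obtain ⟨a, ha, b, hb, rfl, -⟩ := mem_mulParts.1 hp
  obtain ⟨hxa, hxb⟩ := Finset.mem_inter.1 hx
  rw [labelAt_eq _ hp hx, labelAt_eq _ ha hxa, labelAt_eq _ hb hxb]

end Mul

section OfFun

variable {α : Type*} [LinearOrder α] (φ : Fin n → α) (γ : α → G)

/-- The ordered `G`-partition into the level sets of `φ`, in increasing order of the value, where
the level set of `a` has the label `γ a`. -/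
def ofFun : OrderedGPartition n G where
  parts := ((Finset.univ.image φ).sort (· ≤ ·)).map
    fun a => (Finset.univ.filter fun x => φ x = a, γ a)
  nonempty := by
    simp only [List.mem_map, Finset.mem_sort, Finset.mem_image, Finset.mem_univ, true_and]
    rintro _ ⟨_, ⟨x, rfl⟩, rfl⟩
    exact ⟨x, by simp⟩
  disjoint := by
    refine List.Pairwise.map _ (fun a b hab => ?_) (Finset.sort_nodup _ _)
    exact Finset.disjoint_filter.2 fun x _ hxa hxb => hab (hxa.symm.trans hxb)
  cover x := ⟨_, List.mem_map.2 ⟨φ x, by simp, rfl⟩, by simp⟩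

theorem sortedBy_ofFun : (ofFun φ γ).SortedBy φ where
  lt := by
    refine List.pairwise_map.2 ((Finset.sortedLT_sort _).pairwise.imp fun hab x hx y hy => ?_)
    rwa [(Finset.mem_filter.1 hx).2, (Finset.mem_filter.1 hy).2]
  eq p hp x hx y hy := by
    obtain ⟨a, -, rfl⟩ := List.mem_map.1 hp
    rw [(Finset.mem_filter.1 hx).2, (Finset.mem_filter.1 hy).2]

@[simp]
theorem rank_ofFun_lt_iff : (ofFun φ γ).rank x < (ofFun φ γ).rank y ↔ φ x < φ y :=
  (sortedBy_ofFun φ γ).rank_lt_iff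

@[simp]
theorem rank_ofFun_eq_iff : (ofFun φ γ).rank x = (ofFun φ γ).rank y ↔ φ x = φ y :=
  (sortedBy_ofFun φ γ).rank_eq_iff

@[simp]
theorem labelAt_ofFun (x : Fin n) : (ofFun φ γ).labelAt x = γ (φ x) :=
  labelAt_eq (ofFun φ γ) (List.mem_map.2 ⟨φ x, by simp, rfl⟩) (by simp)

end OfFun

section Unlabel

/-- The ordered `G`-partition with the blocks of `σ`, in the same order, all labelled by `1`. -/
def unlabel [One G] : OrderedGPartition n G := ofFun σ.rank fun _ => 1

@[simp]
theorem rank_unlabel_lt_iff [One G] : σ.unlabel.rank x < σ.unlabel.rank y ↔ σ.rank x < σ.rank y :=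
  rank_ofFun_lt_iff ..

@[simp]
theorem rank_unlabel_eq_iff [One G] : σ.unlabel.rank x = σ.unlabel.rank y ↔ σ.rank x = σ.rank y :=
  rank_ofFun_eq_iff ..

@[simp]
theorem labelAt_unlabel [One G] (x : Fin n) : σ.unlabel.labelAt x = 1 := labelAt_ofFun ..

variable [MulOneClass G]

theorem mul_unlabel : σ * σ.unlabel = σ :=
  ext_rank (fun x y => by simp only [rank_mul_lt_iff, rank_unlabel_lt_iff]; lia) (by simp)

theorem unlabel_mul : σ.unlabel * σ = σ :=
  ext_rank (fun x y => by simp only [rank_mul_lt_iff, rank_unlabel_lt_iff]; lia) (by simp)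

theorem mul_mul_of_labelAt_eq_one {ε : OrderedGPartition n G} (hε : ∀ x, ε.labelAt x = 1) :
    ε * σ * ε = ε * σ :=
  ext_rank (fun x y => by simp only [rank_mul_lt_iff, rank_mul_eq_iff]; lia) (by simp [hε])

end Unlabel

section Front

variable [One G]

/-- The ordered `G`-partition into `s`, labelled by `g`, followed by the complement of `s`, labelled
by `1`; one of the two is omitted if it is empty. -/
def front (s : Finset (Fin n)) (g : G) : OrderedGPartition n G :=
  ofFun (fun x => decide (x ∉ s)) fun b => if b then 1 else g

variable {s t : Finset (Fin n)} {g : G}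

@[simp]
theorem rank_front_lt_iff : (front s g).rank x < (front s g).rank y ↔ x ∈ s ∧ y ∉ s := by
  simp [front, Bool.lt_iff]

@[simp]
theorem rank_front_eq_iff : (front s g).rank x = (front s g).rank y ↔ (x ∈ s ↔ y ∈ s) := by
  simp [front]

theorem labelAt_front (x : Fin n) : (front s g).labelAt x = if x ∈ s then g else 1 := by
  simp [front]

@[simp]
theorem labelAt_front_one (x : Fin n) : (front s (1 : G)).labelAt x = 1 := by
  simp [labelAt_front]

end Front

theorem front_mul_front_comm [MulOneClass G] {s t : Finset (Fin n)} (hst : s ⊆ t) :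
    front t (1 : G) * front s 1 = front s 1 * front t 1 :=
  ext_rank (fun x y => by
    have hx := @hst x
    have hy := @hst y
    simp only [rank_mul_lt_iff, rank_front_lt_iff, rank_front_eq_iff]
    tauto) (by simp)

theorem front_rank_le_mul [MulOneClass G] (x : Fin n) :
    front (Finset.univ.filter fun z => σ.rank z ≤ σ.rank x) 1 * σ = σ :=
  ext_rank (fun y z => by
    simp only [rank_mul_lt_iff, rank_front_lt_iff, rank_front_eq_iff, Finset.mem_filter_univ]
    lia) (by simp)

end OrderedGPartition

/-! ### Blocks and refinement -/

namespace LabelledSetPartition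

variable {n : ℕ} {X : Type w} (P : LabelledSetPartition n X)

instance : Finite P.Block := Subtype.finite

/-- A total order on the blocks of `P`, without significance: it serves to turn `P` into an ordered
`G`-partition. -/
noncomputable instance : LinearOrder P.Block :=
  LinearOrder.lift' (Finite.equivFin P.Block) (Finite.equivFin P.Block).injective

theorem exists_mem_block (x : Fin n) : ∃ B : P.Block, x ∈ B.1 := by
  obtain ⟨p, hp, hx⟩ := P.cover x
  exact ⟨⟨p.1, p.2, hp⟩, hx⟩

/-- The block of `P` containing `x`. -/
noncomputable def blockOf (x : Fin n) : P.Block := (P.exists_mem_block x).choose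

theorem mem_blockOf (x : Fin n) : x ∈ (P.blockOf x).1 := (P.exists_mem_block x).choose_spec

variable {P} in
theorem mem_block_iff {B : P.Block} {x : Fin n} : x ∈ B.1 ↔ P.blockOf x = B := by
  refine ⟨fun hx => ?_, fun h => h ▸ P.mem_blockOf x⟩
  by_contra hne
  exact Finset.disjoint_left.1 (P.disjoint _ (P.label_mem _) _ (P.label_mem B)
    fun e => hne (Subtype.ext (congrArg Prod.fst e))) (P.mem_blockOf x) hx

theorem blockOf_surjective : Function.Surjective P.blockOf := fun B => by
  obtain ⟨x, hx⟩ := P.nonempty _ (P.label_mem B)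
  exact ⟨x, mem_block_iff.1 hx⟩

theorem mem_carrier_iff {p : Finset (Fin n) × X} :
    p ∈ P.carrier ↔ ∃ x, p = ((P.blockOf x).1, P.label (P.blockOf x)) := by
  constructor
  · intro hp
    obtain ⟨x, hx⟩ := P.blockOf_surjective ⟨p.1, p.2, hp⟩
    exact ⟨x, hx ▸ Prod.ext rfl (P.label_eq ⟨p.1, p.2, hp⟩ hp).symm⟩
  · rintro ⟨x, rfl⟩
    exact P.label_mem _

variable {P} in
theorem ext_blockOf {Q : LabelledSetPartition n X}
    (hblock : ∀ x y, P.blockOf x = P.blockOf y ↔ Q.blockOf x = Q.blockOf y)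
    (hlabel : ∀ x, P.label (P.blockOf x) = Q.label (Q.blockOf x)) : P = Q := by
  have hmem (x : Fin n) : (P.blockOf x).1 = (Q.blockOf x).1 := by
    ext y
    rw [mem_block_iff, mem_block_iff, hblock]
  refine LabelledSetPartition.ext (Set.ext fun p => ?_)
  simp only [mem_carrier_iff, hmem, hlabel]

section Refines

variable {G : Type v} {σ : OrderedGPartition n G}

variable {P}

theorem refines_iff :
    P.Refines σ ↔ ∀ x y, P.blockOf x = P.blockOf y → σ.rank x = σ.rank y := by
  constructor
  · intro h x y hxy
    obtain ⟨q, hq, hB⟩ := h (P.blockOf x)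
    exact σ.rank_eq_rank_iff.2 ⟨q, hq, hB (P.mem_blockOf x), hB (hxy ▸ P.mem_blockOf y)⟩
  · intro h B
    obtain ⟨x, rfl⟩ := P.blockOf_surjective B
    refine ⟨_, List.getElem_mem (σ.rank_lt_length x), fun y hy => ?_⟩
    simpa only [h x y (mem_block_iff.1 hy).symm] using σ.mem_getElem_rank y

theorem Refines.rank_eq (h : P.Refines σ) {x y : Fin n} (hxy : P.blockOf x = P.blockOf y) :
    σ.rank x = σ.rank y :=
  refines_iff.1 h x y hxy

theorem Refines.value_blockOf (h : P.Refines σ) (x : Fin n) :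
    h.value (P.blockOf x) = σ.labelAt x :=
  (σ.labelAt_eq (h _).choose_spec.1 ((h _).choose_spec.2 (P.mem_blockOf x))).symm

theorem Refines.value_eq_value {Y : Type*} {Q : LabelledSetPartition n Y} (hP : P.Refines σ)
    (hQ : Q.Refines σ) {B : P.Block} {C : Q.Block} (hBC : B.1 ⊆ C.1) :
    hP.value B = hQ.value C :=
  hP.value_eq B (hQ C).choose_spec.1 (hBC.trans (hQ C).choose_spec.2)

theorem refines_unlabel [One G] : P.Refines σ.unlabel ↔ P.Refines σ := by
  simp only [refines_iff, OrderedGPartition.rank_unlabel_eq_iff]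

theorem refines_front [One G] (B : P.Block) (g : G) :
    P.Refines (OrderedGPartition.front B.1 g) :=
  refines_iff.2 fun x y h => by
    rw [OrderedGPartition.rank_front_eq_iff, mem_block_iff, mem_block_iff, h]

end Refines

section Ordered

variable {G : Type v}

/-- The blocks of `P`, labelled by `γ`, in the chosen total order. -/
noncomputable def ordered (γ : P.Block → G) : OrderedGPartition n G := .ofFun P.blockOf γ

variable (γ δ : P.Block → G) {x y : Fin n}

@[simp]
theorem rank_ordered_lt_iff :
    (P.ordered γ).rank x < (P.ordered γ).rank y ↔ P.blockOf x < P.blockOf y :=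
  OrderedGPartition.rank_ofFun_lt_iff ..

@[simp]
theorem rank_ordered_eq_iff :
    (P.ordered γ).rank x = (P.ordered γ).rank y ↔ P.blockOf x = P.blockOf y :=
  OrderedGPartition.rank_ofFun_eq_iff ..

@[simp]
theorem labelAt_ordered (x : Fin n) : (P.ordered γ).labelAt x = γ (P.blockOf x) :=
  OrderedGPartition.labelAt_ofFun ..

theorem refines_ordered : P.Refines (P.ordered γ) :=
  refines_iff.2 fun _ _ => (P.rank_ordered_eq_iff γ).2

theorem value_ordered (h : P.Refines (P.ordered γ)) (B : P.Block) : h.value B = γ B := by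
  obtain ⟨x, rfl⟩ := P.blockOf_surjective B
  rw [h.value_blockOf, labelAt_ordered]

theorem ordered_mul_ordered [Mul G] : P.ordered γ * P.ordered δ = P.ordered (γ * δ) :=
  OrderedGPartition.ext_rank (fun x y => by
    simp only [OrderedGPartition.rank_mul_lt_iff, rank_ordered_lt_iff, rank_ordered_eq_iff]
    grind) (by simp)

variable {P} in
theorem Refines.ordered_one_mul [MulOneClass G] {σ : OrderedGPartition n G} (h : P.Refines σ) :
    P.ordered 1 * σ = P.ordered h.value :=
  OrderedGPartition.ext_rank (fun x y => by
    have := h.rank_eq (x := x) (y := y)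
    simp only [OrderedGPartition.rank_mul_lt_iff, rank_ordered_lt_iff, rank_ordered_eq_iff]
    grind) (by simp [h.value_blockOf])

end Ordered

end LabelledSetPartition

/-! ### `Ext¹` of monoid representations as cocycles modulo coboundaries -/

section ExtOne

variable {C : Type*} [Category C] [Abelian C] [HasExt.{w} C] (R : Type*) [CommRing R] [Linear R C]
  {S : ShortComplex C} (hS : S.ShortExact) (Y : C)

/-- The connecting map `Hom(S.X₁, Y) → Ext¹(S.X₃, Y)` of a short exact sequence, as a linear map. -/
noncomputable def extConnecting : (S.X₁ ⟶ Y) →ₗ[R] Abelian.Ext.{w} S.X₃ Y 1 :=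
  Abelian.Ext.precompOfLinear hS.extClass R Y (add_zero 1) ∘ₗ
    (Abelian.Ext.linearEquiv₀ (R := R)).symm.toLinearMap

theorem extConnecting_apply (φ : S.X₁ ⟶ Y) :
    extConnecting R hS Y φ = hS.extClass.comp (Abelian.Ext.mk₀ φ) (add_zero 1) := rfl

theorem extConnecting_surjective [Projective S.X₂] :
    Function.Surjective (extConnecting R hS Y) := fun x => by
  obtain ⟨x₁, rfl⟩ := Abelian.Ext.contravariant_sequence_exact₃ hS Y x
    (Abelian.Ext.eq_zero_of_projective _) (add_zero 1)
  obtain ⟨φ, rfl⟩ := (Abelian.Ext.mk₀_bijective S.X₁ Y).2 x₁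
  exact ⟨φ, rfl⟩

theorem ker_extConnecting :
    LinearMap.ker (extConnecting R hS Y) = LinearMap.range (Linear.leftComp R Y S.f) := by
  ext φ
  rw [LinearMap.mem_ker, extConnecting_apply]
  constructor
  · intro hφ
    obtain ⟨x₂, hx₂⟩ := Abelian.Ext.contravariant_sequence_exact₁ hS Y _ (add_zero 1) hφ
    obtain ⟨ψ, rfl⟩ := (Abelian.Ext.mk₀_bijective S.X₂ Y).2 x₂
    rw [Abelian.Ext.mk₀_comp_mk₀] at hx₂
    exact ⟨ψ, (Abelian.Ext.mk₀_bijective S.X₁ Y).1 hx₂⟩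
  · rintro ⟨ψ, rfl⟩
    rw [Linear.leftComp_apply, ← Abelian.Ext.mk₀_comp_mk₀, hS.extClass_comp_assoc]

/-- The computation of `Ext¹` by an epimorphism from a projective object `S.X₂` onto `S.X₃` with
kernel `S.X₁`. -/
noncomputable def extOneEquiv [Projective S.X₂] :
    ((S.X₁ ⟶ Y) ⧸ LinearMap.range (Linear.leftComp R Y S.f)) ≃ₗ[R] Abelian.Ext.{w} S.X₃ Y 1 :=
  (Submodule.quotEquivOfEq _ _ (ker_extConnecting R hS Y).symm).trans
    ((extConnecting R hS Y).quotKerEquivOfSurjective (extConnecting_surjective R hS Y))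

end ExtOne

section FreeModule

variable (k : Type*) [Field k] (A : Type*) [Ring A] [Algebra k A] (V Y : Type*)
  [AddCommGroup V] [Module k V] [AddCommGroup Y] [Module k Y] [Module A Y] [IsScalarTower k A Y]

/-- The universal property of the free `A`-module `A ⊗ V` on a vector space `V`. -/
noncomputable def freeModuleLift : (V →ₗ[k] Y) ≃ₗ[k] (A ⊗[k] V →ₗ[A] Y) :=
  (LinearMap.ringLmapEquivSelf A k (V →ₗ[k] Y)).symm ≪≫ₗ
    TensorProduct.AlgebraTensorModule.lift.equiv k A k A V Y

@[simp]
theorem freeModuleLift_tmul (h : V →ₗ[k] Y) (a : A) (x : V) :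
    freeModuleLift k A V Y h (a ⊗ₜ x) = a • h x := rfl

end FreeModule

section Cocycles

variable {k : Type u} [Field k] {M : Type v} [Monoid M] {V W : Type*} [AddCommGroup V] [Module k V]
  [AddCommGroup W] [Module k W] (ρ : Representation k M V) (τ : Representation k M W)

/-- The `1`-cocycles (derivations) of a monoid with values in the bimodule `Hom(V, W)`. -/
def cocycles : Submodule k (M → V →ₗ[k] W) where
  carrier := {c | ∀ m m' x, c (m * m') x = τ m (c m' x) + c m (ρ m' x)}
  add_mem' {c d} hc hd m m' x := by
    simp only [Pi.add_apply, LinearMap.add_apply, hc m m' x, hd m m' x, map_add]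
    abel
  zero_mem' := by simp
  smul_mem' r c hc m m' x := by simp [hc m m' x]

variable {ρ τ} in
theorem cocycle_mul (c : cocycles ρ τ) (m m' : M) (x : V) :
    c.1 (m * m') x = τ m (c.1 m' x) + c.1 m (ρ m' x) := c.2 m m' x

variable {ρ τ} in
theorem cocycle_one (c : cocycles ρ τ) (x : V) : c.1 1 x = 0 := by
  simpa using cocycle_mul c 1 1 x

/-- The `1`-coboundary (inner derivation) `m ↦ τ m ∘ h - h ∘ ρ m` of a linear map `h`. -/
def coboundary : (V →ₗ[k] W) →ₗ[k] cocycles ρ τ where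
  toFun h := ⟨fun m => τ m ∘ₗ h - h ∘ₗ ρ m, fun m m' x => by simp⟩
  map_add' h h' := by
    ext m x
    simp only [LinearMap.comp_add, LinearMap.add_comp, Submodule.coe_add, Pi.add_apply,
      LinearMap.sub_apply, LinearMap.add_apply]
    abel
  map_smul' r h := by
    ext m x
    simp [smul_sub]

@[simp]
theorem coboundary_apply (h : V →ₗ[k] W) (m : M) (x : V) :
    (coboundary ρ τ h).1 m x = τ m (h x) - h (ρ m x) := rfl

/-- The first cohomology of a monoid with values in the bimodule `Hom(V, W)`. -/
abbrev cohomologyOne : Type _ := cocycles ρ τ ⧸ LinearMap.range (coboundary ρ τ)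

theorem single_smul_eq (m : M) (r : k) (x : ρ.asModule) :
    MonoidAlgebra.single m r • x = ρ.asModuleEquiv.symm (r • ρ m (ρ.asModuleEquiv x)) :=
  ρ.single_smul r m x

/-- The surjection from a free module onto the module of `ρ`. -/
noncomputable def freeCover : MonoidAlgebra k M ⊗[k] V →ₗ[MonoidAlgebra k M] ρ.asModule :=
  freeModuleLift k _ V ρ.asModule ρ.asModuleEquiv.symm

theorem freeCover_single_tmul (m : M) (r : k) (x : V) :
    freeCover ρ (MonoidAlgebra.single m r ⊗ₜ x) = ρ.asModuleEquiv.symm (r • ρ m x) :=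
  ρ.single_smul r m (ρ.asModuleEquiv.symm x)

theorem freeCover_surjective : Function.Surjective (freeCover ρ) := fun x =>
  ⟨MonoidAlgebra.single 1 1 ⊗ₜ ρ.asModuleEquiv x, by simp [freeCover_single_tmul]⟩

/-- The projection of the free module onto the kernel of `freeCover ρ` along `1 ⊗ V`. It sends
`m ⊗ x` to the relation `m ⊗ x - 1 ⊗ m x`, and these span the kernel. -/
noncomputable def kerProjection :
    MonoidAlgebra k M ⊗[k] V →ₗ[k] LinearMap.ker (freeCover ρ) :=
  LinearMap.codRestrict ((LinearMap.ker (freeCover ρ)).restrictScalars k)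
    (LinearMap.id - TensorProduct.mk k _ V 1 ∘ₗ ρ.asModuleEquiv.toLinearMap ∘ₗ
      (freeCover ρ).restrictScalars k) fun z => by
    simp [MonoidAlgebra.one_def, freeCover_single_tmul]

theorem coe_kerProjection (z : MonoidAlgebra k M ⊗[k] V) :
    (kerProjection ρ z).1 = z - 1 ⊗ₜ ρ.asModuleEquiv (freeCover ρ z) := rfl

theorem kerProjection_apply (z : LinearMap.ker (freeCover ρ)) : kerProjection ρ z.1 = z :=
  Subtype.ext <| by
    have hz : freeCover ρ z.1 = 0 := z.2
    simp [coe_kerProjection, hz]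

theorem coe_kerProjection_single_tmul (m : M) (x : V) :
    (kerProjection ρ (MonoidAlgebra.single m 1 ⊗ₜ x)).1 =
      MonoidAlgebra.single m 1 ⊗ₜ x - MonoidAlgebra.single 1 1 ⊗ₜ ρ m x := by
  rw [coe_kerProjection, freeCover_single_tmul, one_smul, LinearEquiv.apply_symm_apply,
    MonoidAlgebra.one_def]

theorem kerProjection_single_mul_tmul (m m' : M) (x : V) :
    kerProjection ρ (MonoidAlgebra.single (m * m') 1 ⊗ₜ x) =
      MonoidAlgebra.single m (1 : k) • kerProjection ρ (MonoidAlgebra.single m' 1 ⊗ₜ x) +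
        kerProjection ρ (MonoidAlgebra.single m 1 ⊗ₜ ρ m' x) :=
  Subtype.ext <| by
    simp only [Submodule.coe_add, Submodule.coe_smul, coe_kerProjection_single_tmul, smul_sub,
      TensorProduct.smul_tmul', smul_eq_mul, MonoidAlgebra.single_mul_single, mul_one, map_mul,
      Module.End.mul_apply]
    abel

variable {ρ τ} in
theorem ker_freeCover_hom_ext {φ ψ : LinearMap.ker (freeCover ρ) →ₗ[MonoidAlgebra k M] τ.asModule}
    (h : ∀ m x, φ (kerProjection ρ (MonoidAlgebra.single m 1 ⊗ₜ x)) =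
      ψ (kerProjection ρ (MonoidAlgebra.single m 1 ⊗ₜ x))) : φ = ψ := by
  have key : φ.restrictScalars k ∘ₗ kerProjection ρ = ψ.restrictScalars k ∘ₗ kerProjection ρ := by
    ext m x
    exact h m x
  ext z
  rw [← kerProjection_apply ρ z]
  exact LinearMap.congr_fun key z.1

/-- The cocycle `m ↦ (x ↦ φ (m ⊗ x - 1 ⊗ m x))`. -/
noncomputable def cocycleOfHom :
    (LinearMap.ker (freeCover ρ) →ₗ[MonoidAlgebra k M] τ.asModule) →ₗ[k] cocycles ρ τ where
  toFun φ := ⟨fun m => τ.asModuleEquiv.toLinearMap ∘ₗ φ.restrictScalars k ∘ₗ kerProjection ρ ∘ₗ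
      TensorProduct.mk k _ V (MonoidAlgebra.single m 1), fun m m' x => by
    simp [-Representation.single_smul, -Representation.asModuleEquiv_symm_map_rho,
      kerProjection_single_mul_tmul, single_smul_eq]⟩
  map_add' _ _ := rfl
  map_smul' _ _ := rfl

theorem cocycleOfHom_apply (φ : LinearMap.ker (freeCover ρ) →ₗ[MonoidAlgebra k M] τ.asModule)
    (m : M) (x : V) : (cocycleOfHom ρ τ φ).1 m x =
      τ.asModuleEquiv (φ (kerProjection ρ (MonoidAlgebra.single m 1 ⊗ₜ x))) := rfl

theorem cocycleOfHom_injective : Function.Injective (cocycleOfHom ρ τ) := fun _ _ h =>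
  ker_freeCover_hom_ext fun m x =>
    τ.asModuleEquiv.injective (LinearMap.congr_fun (congrFun (congrArg Subtype.val h) m) x)

variable {ρ τ}

/-- The linear map `m ⊗ x ↦ c m x` on the free module. -/
noncomputable def cocycleLift (c : cocycles ρ τ) : MonoidAlgebra k M ⊗[k] V →ₗ[k] τ.asModule :=
  τ.asModuleEquiv.symm.toLinearMap ∘ₗ TensorProduct.lift
    (Finsupp.linearCombination k c.1 ∘ₗ (MonoidAlgebra.coeffLinearEquiv k).toLinearMap)

theorem cocycleLift_single_tmul (c : cocycles ρ τ) (m : M) (r : k) (x : V) :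
    cocycleLift c (MonoidAlgebra.single m r ⊗ₜ x) = τ.asModuleEquiv.symm (r • c.1 m x) := by
  simp [cocycleLift]

theorem cocycleLift_single_smul (c : cocycles ρ τ) (m : M) (z : MonoidAlgebra k M ⊗[k] V) :
    cocycleLift c (MonoidAlgebra.single m (1 : k) • z) =
      MonoidAlgebra.single m (1 : k) • cocycleLift c z +
        τ.asModuleEquiv.symm (c.1 m (ρ.asModuleEquiv (freeCover ρ z))) := by
  induction z using TensorProduct.induction_on with
  | zero => simp
  | add z z' hz hz' =>
    simp only [smul_add, map_add, hz, hz']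
    abel
  | tmul a x =>
    induction a using MonoidAlgebra.induction_linear with
    | zero => simp
    | add a a' ha ha' =>
      simp only [TensorProduct.add_tmul, smul_add, map_add, ha, ha']
      abel
    | single m' r =>
      simp [-Representation.single_smul, -Representation.asModuleEquiv_symm_map_rho,
        TensorProduct.smul_tmul', MonoidAlgebra.single_mul_single, cocycleLift_single_tmul,
        freeCover_single_tmul, single_smul_eq, cocycle_mul, smul_add]

theorem cocycleOfHom_surjective : Function.Surjective (cocycleOfHom ρ τ) := fun c => by
  let φ : LinearMap.ker (freeCover ρ) →ₗ[MonoidAlgebra k M] τ.asModule :=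
    MonoidAlgebra.equivariantOfLinearOfComm
      (cocycleLift c ∘ₗ (LinearMap.ker (freeCover ρ)).subtype.restrictScalars k) fun m z => by
      have hz : freeCover ρ z.1 = 0 := z.2
      simp [-Representation.single_smul, -Representation.asModuleEquiv_symm_map_rho,
        cocycleLift_single_smul, hz]
  refine ⟨φ, Subtype.ext (funext fun m => LinearMap.ext fun x => ?_)⟩
  change τ.asModuleEquiv (cocycleLift c
    (kerProjection ρ (MonoidAlgebra.single m 1 ⊗ₜ x)).1) = c.1 m x
  simp [coe_kerProjection_single_tmul, cocycleLift_single_tmul, cocycle_one]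

variable (ρ τ) in
/-- Homomorphisms on the kernel of the free cover are the same as cocycles. -/
noncomputable def cocycleEquiv :
    (LinearMap.ker (freeCover ρ) →ₗ[MonoidAlgebra k M] τ.asModule) ≃ₗ[k] cocycles ρ τ :=
  LinearEquiv.ofBijective (cocycleOfHom ρ τ) ⟨cocycleOfHom_injective ρ τ, cocycleOfHom_surjective⟩

theorem cocycleOfHom_comp_subtype (h : V →ₗ[k] τ.asModule) :
    cocycleOfHom ρ τ (freeModuleLift k _ V τ.asModule h ∘ₗ (LinearMap.ker (freeCover ρ)).subtype) =
      coboundary ρ τ (τ.asModuleEquiv.toLinearMap ∘ₗ h) := by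
  ext m x
  simp [-Representation.single_smul, -Representation.asModuleEquiv_symm_map_rho,
    cocycleOfHom_apply, coe_kerProjection_single_tmul, single_smul_eq]

end Cocycles

section GabrielArrows

/-- The vector space of homomorphisms in `ModuleCat A`, carried along isomorphisms of its source
and of its target. -/
noncomputable def homLinearEquiv {k : Type*} [Field k] {A : Type*} [Ring A] [Algebra k A]
    {X Y : ModuleCat.{w} A} {X' Y' : Type*} [AddCommGroup X'] [Module A X'] [AddCommGroup Y']
    [Module k Y'] [Module A Y'] [IsScalarTower k A Y'] (e : X ≃ₗ[A] X') (f : Y ≃ₗ[A] Y') :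
    (X ⟶ Y) ≃ₗ[k] (X' →ₗ[A] Y') where
  toFun φ := f.toLinearMap ∘ₗ φ.hom ∘ₗ e.symm.toLinearMap
  invFun φ := ModuleCat.ofHom (f.symm.toLinearMap ∘ₗ φ ∘ₗ e.toLinearMap)
  map_add' φ ψ := by ext; simp
  map_smul' r φ := by
    ext x
    change f (algebraMap k A r • φ.hom (e.symm x)) = r • f (φ.hom (e.symm x))
    rw [map_smul, algebraMap_smul]
  left_inv φ := by ext; simp
  right_inv φ := by ext; simp

variable {k : Type u} [Field k] {M : Type v} [Monoid M] {V W : Type max u v}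
  [AddCommGroup V] [Module k V] [AddCommGroup W] [Module k W]
  {ρ : Representation k M V} {τ : Representation k M W} {S T : SimpleClass (MonoidAlgebra k M)}

theorem gabrielArrows_eq_rank_cohomologyOne (e : S.rep ≃ₗ[MonoidAlgebra k M] ρ.asModule)
    (f : T.rep ≃ₗ[MonoidAlgebra k M] τ.asModule) :
    gabrielArrows k (MonoidAlgebra k M) S T = Module.rank k (cohomologyOne ρ τ) := by
  let K := LinearMap.shortComplexKer (e.symm.toLinearMap ∘ₗ freeCover ρ)
  have hK : K.ShortExact :=
    LinearMap.shortExact_shortComplexKer (e.symm.surjective.comp (freeCover_surjective ρ))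
  have : Projective K.X₂ := (IsProjective.iff_projective (R := MonoidAlgebra k M)
    (MonoidAlgebra k M ⊗[k] V)).1 inferInstance
  let ι : K.X₁ ≃ₗ[MonoidAlgebra k M] LinearMap.ker (freeCover ρ) :=
    LinearEquiv.ofEq _ _ (e.symm.ker_comp (freeCover ρ))
  let Θ₁ : (K.X₁ ⟶ T.rep) ≃ₗ[k] (LinearMap.ker (freeCover ρ) →ₗ[MonoidAlgebra k M] τ.asModule) :=
    homLinearEquiv (X' := LinearMap.ker (freeCover ρ)) (Y' := τ.asModule) ι f
  let Θ : (K.X₁ ⟶ T.rep) ≃ₗ[k] cocycles ρ τ := Θ₁.trans (cocycleEquiv ρ τ)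
  let Ψ : (K.X₂ ⟶ T.rep) ≃ₗ[k] (V →ₗ[k] W) :=
    (homLinearEquiv (.refl _ _) f).trans ((freeModuleLift k _ V τ.asModule).symm.trans
      (LinearEquiv.congrRight τ.asModuleEquiv))
  have hΘ : Θ.toLinearMap ∘ₗ Linear.leftComp k T.rep K.f = coboundary ρ τ ∘ₗ Ψ.toLinearMap := by
    ext1 ψ
    obtain ⟨h, rfl⟩ := Ψ.symm.surjective ψ
    have hΘ₁ : Θ₁ (K.f ≫ Ψ.symm h) =
        freeModuleLift k _ V τ.asModule (τ.asModuleEquiv.symm.toLinearMap ∘ₗ h) ∘ₗ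
          (LinearMap.ker (freeCover ρ)).subtype := by
      ext z
      exact f.apply_symm_apply _
    change cocycleOfHom ρ τ (Θ₁ (K.f ≫ Ψ.symm h)) = coboundary ρ τ (Ψ (Ψ.symm h))
    rw [hΘ₁, cocycleOfHom_comp_subtype, Ψ.apply_symm_apply]
    rfl
  have hrange : (LinearMap.range (Linear.leftComp k T.rep K.f)).map Θ.toLinearMap =
      LinearMap.range (coboundary ρ τ) := by
    rw [← LinearMap.range_comp, hΘ, LinearMap.range_comp, LinearEquiv.range, Submodule.map_top]
  exact ((extOneEquiv k hK T.rep).symm.trans (Submodule.Quotient.equiv _ _ Θ hrange)).rank_eq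

theorem gabrielArrows_eq_zero (e : S.rep ≃ₗ[MonoidAlgebra k M] ρ.asModule)
    (f : T.rep ≃ₗ[MonoidAlgebra k M] τ.asModule)
    (h : LinearMap.range (coboundary ρ τ) = ⊤) : gabrielArrows k (MonoidAlgebra k M) S T = 0 := by
  have : Subsingleton (cohomologyOne ρ τ) := Submodule.Quotient.subsingleton_iff.2 h
  rw [gabrielArrows_eq_rank_cohomologyOne e f, rank_subsingleton']

end GabrielArrows

/-! ### Outer tensor products of irreducible representations -/

section Burnside

variable {k G V : Type*} [Field k] [IsAlgClosed k] [Monoid G] [AddCommGroup V] [Module k V]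
  [FiniteDimensional k V]

/- By Schur's lemma every `k`-linear operator is linear over the endomorphism ring of the simple
module, so the density theorem realizes it by an element of the algebra. -/
theorem asAlgebraHom_surjective_of_isIrreducible (ρ : Representation k G V) [ρ.IsIrreducible] :
    Function.Surjective ρ.asAlgebraHom := by
  intro T
  have schur := (IsSimpleModule.algebraMap_end_bijective_of_isAlgClosed (A := MonoidAlgebra k G)
    (V := ρ.asModule) k).2
  let T' : ρ.asModule →ₗ[k] ρ.asModule := T
  let f : Module.End (Module.End (MonoidAlgebra k G) ρ.asModule) ρ.asModule :=
    { toFun := T'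
      map_add' := T'.map_add
      map_smul' := by
        intro φ x
        obtain ⟨c, rfl⟩ := schur φ
        exact T'.map_smul c x }
  obtain ⟨s, hs⟩ := Module.Finite.fg_top (R := k) (M := ρ.asModule)
  obtain ⟨r, hr⟩ := jacobson_density f s
  have hT : ρ.asAlgebraHom r = T' := LinearMap.ext_on hs fun m hm => (hr m hm).symm
  exact ⟨r, hT⟩

theorem span_range_eq_top_of_isIrreducible (ρ : Representation k G V) [ρ.IsIrreducible] :
    Submodule.span k (Set.range ρ) = ⊤ := by
  rw [eq_top_iff]
  rintro T -
  obtain ⟨r, rfl⟩ := asAlgebraHom_surjective_of_isIrreducible ρ T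
  induction r using MonoidAlgebra.induction_linear with
  | zero => simp
  | add x y hx hy =>
    rw [map_add]
    exact Submodule.add_mem _ hx hy
  | single g c =>
    rw [Representation.asAlgebraHom_single]
    exact Submodule.smul_mem _ _ (Submodule.subset_span ⟨g, rfl⟩)

end Burnside

section Irreducible

variable {k G V : Type*} [Field k] [Monoid G] [AddCommGroup V] [Module k V]

theorem isIrreducible_of_stable [Nontrivial V] {ρ : Representation k G V}
    (h : ∀ N : Submodule k V, (∀ g, ∀ x ∈ N, ρ g x ∈ N) → ∀ x ∈ N, x ≠ 0 → N = ⊤) :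
    ρ.IsIrreducible where
  exists_pair_ne := by
    refine ⟨⊥, ⊤, fun e => ?_⟩
    exact bot_ne_top (congrArg Subrepresentation.toSubmodule e : (⊥ : Submodule k V) = ⊤)
  eq_bot_or_eq_top N := by
    by_cases hN : ∃ x ∈ N.toSubmodule, x ≠ 0
    · obtain ⟨x, hx, hx0⟩ := hN
      exact Or.inr (Subrepresentation.toSubmodule_injective
        (h N.toSubmodule (fun g y hy => N.apply_mem_toSubmodule g hy) x hx hx0))
    · push Not at hN
      exact Or.inl (Subrepresentation.toSubmodule_injective ((Submodule.eq_bot_iff _).2 hN))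

theorem nontrivial_of_isIrreducible (ρ : Representation k G V) [ρ.IsIrreducible] :
    Nontrivial V := by
  by_contra h
  rw [not_nontrivial_iff_subsingleton] at h
  obtain ⟨N, N', hne⟩ := exists_pair_ne (Subrepresentation ρ)
  exact hne (Subrepresentation.toSubmodule_injective (Subsingleton.elim _ _))

theorem apply_mem_of_mem_span_range {ρ : Representation k G V} {N : Submodule k V}
    (hN : ∀ g, ∀ x ∈ N, ρ g x ∈ N) {T : V →ₗ[k] V} (hT : T ∈ Submodule.span k (Set.range ρ))
    {x : V} (hx : x ∈ N) : T x ∈ N := by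
  induction hT using Submodule.span_induction with
  | mem T hT =>
    obtain ⟨g, rfl⟩ := hT
    exact hN g x hx
  | zero => exact N.zero_mem
  | add T T' _ _ h h' => exact N.add_mem h h'
  | smul c T _ h => exact N.smul_mem c h

theorem isIrreducible_of_mem_span_range {H : Type*} [Monoid H] (ρ : Representation k G V)
    [ρ.IsIrreducible] {τ : Representation k H V}
    (h : ∀ g, ρ g ∈ Submodule.span k (Set.range τ)) : τ.IsIrreducible := by
  have := nontrivial_of_isIrreducible ρ
  refine isIrreducible_of_stable fun N hN x hx hx0 => ?_
  let N' : Subrepresentation ρ := ⟨N, fun g _ hy => apply_mem_of_mem_span_range hN (h g) hy⟩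
  refine (eq_bot_or_eq_top N').elim (fun hbot => absurd ?_ hx0)
    fun htop => congrArg Subrepresentation.toSubmodule htop
  have hN : N = ⊥ := congrArg Subrepresentation.toSubmodule hbot
  rwa [hN, Submodule.mem_bot] at hx

end Irreducible

section PiTprod

variable {k G : Type*} [Field k] [Monoid G] {ι : Type*} {V : ι → Type*}
  [∀ i, AddCommGroup (V i)] [∀ i, Module k (V i)]

/-- The outer tensor product of a family of representations of `G`, a representation of the power
`ι → G`. -/
noncomputable def piTprod (ρ : ∀ i, Representation k G (V i)) :
    Representation k (ι → G) (⨂[k] i, V i) where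
  toFun γ := PiTensorProduct.map fun i => ρ i (γ i)
  map_one' := by
    simp only [Pi.one_apply, map_one]
    exact PiTensorProduct.map_one
  map_mul' γ γ' := by
    simp only [Pi.mul_apply, map_mul]
    exact PiTensorProduct.map_mul _ _

@[simp]
theorem piTprod_tprod (ρ : ∀ i, Representation k G (V i)) (γ : ι → G) (v : ∀ i, V i) :
    piTprod ρ γ (PiTensorProduct.tprod k v) = PiTensorProduct.tprod k fun i => ρ i (γ i) (v i) :=
  PiTensorProduct.map_tprod _ _

/- The equivalences `E` go in the direction in which reindexing along `e` needs no transport. -/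
theorem exists_equiv_piTprod {κ : Type*} {W : κ → Type*} [∀ j, AddCommGroup (W j)]
    [∀ j, Module k (W j)] {τ : ∀ j, Representation k G (W j)} {ρ : ∀ i, Representation k G (V i)}
    (e : ι ≃ κ) (E : ∀ i, (τ (e i)).Equiv (ρ i)) :
    ∃ f : (⨂[k] j, W j) ≃ₗ[k] ⨂[k] i, V i,
      ∀ γ x, f (piTprod τ γ x) = piTprod ρ (γ ∘ e) (f x) := by
  let f : (⨂[k] j, W j) ≃ₗ[k] ⨂[k] i, V i :=
    (PiTensorProduct.reindex k W e.symm).trans (PiTensorProduct.congr fun i => (E i).toLinearEquiv)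
  have hf (w) : f (PiTensorProduct.tprod k w) = PiTensorProduct.tprod k fun i => E i (w (e i)) := by
    refine (congrArg (PiTensorProduct.congr _) (PiTensorProduct.reindex_tprod e.symm w)).trans ?_
    exact PiTensorProduct.congr_tprod _ _
  have hE (i g v) : E i (τ (e i) g v) = ρ i g (E i v) :=
    (E i).toIntertwiningMap.isIntertwining _ _ g v
  refine ⟨f, fun γ => LinearMap.congr_fun (f := f.toLinearMap ∘ₗ piTprod τ γ)
    (g := piTprod ρ (γ ∘ e) ∘ₗ f.toLinearMap) (PiTensorProduct.ext ?_)⟩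
  ext w
  simp [hf, hE]

end PiTprod

section PiTprodIrreducible

variable {k G : Type*} [Field k] [Monoid G] {ι : Type*} [Finite ι] {V : ι → Type*}
  [∀ i, AddCommGroup (V i)] [∀ i, Module k (V i)] [∀ i, FiniteDimensional k (V i)]

/- The operators are of rank one: they extract one coordinate of the tensor. -/
theorem exists_map_eq_smul_tprod {x : ⨂[k] i, V i} (hx : x ≠ 0) (w : ∀ i, V i) :
    ∃ a : ∀ i, V i →ₗ[k] V i, ∃ c : k, c ≠ 0 ∧
      PiTensorProduct.map a x = c • PiTensorProduct.tprod k w := by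
  have := Fintype.ofFinite ι
  let b := fun i => Module.finBasis k (V i)
  let B := Basis.piTensorProduct b
  obtain ⟨p, hp⟩ := Finsupp.ne_iff.1 (show B.repr x ≠ 0 by simpa using hx)
  have rank_one : PiTensorProduct.map (fun i => ((b i).coord (p i)).smulRight (w i)) =
      (B.coord p).smulRight (PiTensorProduct.tprod k w) := by
    ext v
    simp [B, MultilinearMap.map_smul_univ]
  exact ⟨_, _, hp, LinearMap.congr_fun rank_one x⟩

variable [IsAlgClosed k] (ρ : ∀ i, Representation k G (V i)) [∀ i, (ρ i).IsIrreducible]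

theorem map_mem_span_range_piTprod (a : ∀ i, V i →ₗ[k] V i) :
    PiTensorProduct.map a ∈ Submodule.span k (Set.range (piTprod ρ)) := by
  have := Fintype.ofFinite ι
  classical
  have ha (i) : ∃ c : G →₀ k, (c.sum fun g t => t • ρ i g) = a i := by
    rw [← Finsupp.mem_span_range_iff_exists_finsupp, span_range_eq_top_of_isIrreducible]
    trivial
  choose c hc using ha
  have expand : PiTensorProduct.map a = ∑ γ ∈ Fintype.piFinset fun i => (c i).support,
      (∏ i, c i (γ i)) • piTprod ρ γ := by
    have h := (PiTensorProduct.mapMultilinear k V V).map_sum_finset (fun i g => c i g • ρ i g)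
      fun i => (c i).support
    have hc' (i) : ∑ g ∈ (c i).support, c i g • ρ i g = a i := hc i
    simp only [hc', PiTensorProduct.mapMultilinear_apply] at h
    rw [h]
    exact Finset.sum_congr rfl fun γ _ =>
      (PiTensorProduct.mapMultilinear k V V).map_smul_univ _ _
  rw [expand]
  exact Submodule.sum_mem _ fun γ _ =>
    Submodule.smul_mem _ _ (Submodule.subset_span ⟨γ, rfl⟩)

instance : (piTprod ρ).IsIrreducible := by
  have := Fintype.ofFinite ι
  have (i : ι) := nontrivial_of_isIrreducible (ρ i)
  have : Nonempty (∀ i, Fin (Module.finrank k (V i))) := ⟨fun i => ⟨0, Module.finrank_pos⟩⟩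
  have : Nontrivial (⨂[k] i, V i) :=
    (Basis.piTensorProduct fun i => Module.finBasis k (V i)).repr.toEquiv.nontrivial
  refine isIrreducible_of_stable fun N hN x hx hx0 => ?_
  rw [eq_top_iff, ← PiTensorProduct.span_tprod_eq_top, Submodule.span_le]
  rintro _ ⟨w, rfl⟩
  obtain ⟨a, c, hc, ha⟩ := exists_map_eq_smul_tprod hx0 w
  exact (N.smul_mem_iff hc).1
    (ha ▸ apply_mem_of_mem_span_range hN (map_mem_span_range_piTprod ρ a) hx)

end PiTprodIrreducible

section OuterTprod

variable {k : Type*} [Field k] {G Γ X U R T : Type*} [Monoid G] [Monoid Γ]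
  [AddCommGroup X] [Module k X] [AddCommGroup U] [Module k U] [AddCommGroup R] [Module k R]
  [AddCommGroup T] [Module k T]

/-- The outer tensor product of two representations, a representation of the product monoid. -/
noncomputable def outerTprod (ρ : Representation k G X) (a : Representation k Γ R) :
    Representation k (G × Γ) (X ⊗[k] R) :=
  Representation.tprod (ρ.comp (MonoidHom.fst G Γ)) (a.comp (MonoidHom.snd G Γ))

@[simp]
theorem outerTprod_apply (ρ : Representation k G X) (a : Representation k Γ R) (p : G × Γ) :
    outerTprod ρ a p = TensorProduct.map (ρ p.1) (a p.2) :=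
  rfl

theorem exists_equiv_outerTprod {J : Type*} {V : Option J → Type*} [∀ o, AddCommGroup (V o)]
    [∀ o, Module k (V o)] (ρ : ∀ o, Representation k G (V o)) :
    ∃ f : (⨂[k] o, V o) ≃ₗ[k] V none ⊗[k] (⨂[k] j, V (some j)),
      ∀ γ x, f (piTprod ρ γ x) =
        outerTprod (ρ none) (piTprod fun j => ρ (some j)) (γ none, fun j => γ (some j)) (f x) := by
  let N (s : J ⊕ PUnit.{1}) : Type _ := V ((Equiv.optionEquivSumPUnit J).symm s)
  let unsum : (⨂[k] s, N s) ≃ₗ[k] (⨂[k] j, V (some j)) ⊗[k] (⨂[k] _ : PUnit.{1}, V none) :=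
    (PiTensorProduct.tmulEquivDep k N).symm
  let evalUnit := PiTensorProduct.subsingletonEquiv (R := k) (s := fun _ : PUnit.{1} => V none) ⟨⟩
  let f : (⨂[k] o, V o) ≃ₗ[k] V none ⊗[k] (⨂[k] j, V (some j)) :=
    (PiTensorProduct.reindex k V (Equiv.optionEquivSumPUnit J)).trans <|
      unsum.trans <|
        (TensorProduct.congr (LinearEquiv.refl k _) evalUnit).trans (TensorProduct.comm k _ _)
  have hf (v) : f (PiTensorProduct.tprod k v) =
      v none ⊗ₜ PiTensorProduct.tprod k fun j => v (some j) := by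
    have h_unsum := PiTensorProduct.tmulEquivDep_symm_apply (R := k) (N := N)
      fun s => v ((Equiv.optionEquivSumPUnit J).symm s)
    have h_eval : evalUnit (PiTensorProduct.tprod k fun _ => v none) = v none :=
      PiTensorProduct.subsingletonEquiv_apply_tprod _ _
    simp only [f, LinearEquiv.trans_apply, PiTensorProduct.reindex_tprod]
    refine (congrArg (fun z => TensorProduct.comm k _ _
      (TensorProduct.congr (LinearEquiv.refl k _) evalUnit z)) h_unsum).trans ?_
    exact congrArg (fun z => z ⊗ₜ[k] PiTensorProduct.tprod k fun j => v (some j)) h_eval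
  refine ⟨f, fun γ => LinearMap.congr_fun (f := f.toLinearMap ∘ₗ piTprod ρ γ)
    (g := TensorProduct.map _ _ ∘ₗ f.toLinearMap) (PiTensorProduct.ext ?_)⟩
  ext v
  simp [hf]

theorem exists_equiv_outerTprod_tprod {J : Type*} {V : Option (Option J) → Type*}
    [∀ o, AddCommGroup (V o)] [∀ o, Module k (V o)] (ρ : ∀ o, Representation k G (V o)) :
    ∃ f : (⨂[k] o, V o) ≃ₗ[k] (V none ⊗[k] V (some none)) ⊗[k] (⨂[k] j, V (some (some j))),
      ∀ g δ x, f (piTprod ρ (fun o => o.elim g fun o => o.elim g δ) x) =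
        outerTprod ((ρ none).tprod (ρ (some none))) (piTprod fun j => ρ (some (some j))) (g, δ)
          (f x) := by
  obtain ⟨e, he⟩ := exists_equiv_outerTprod ρ
  obtain ⟨f, hf⟩ := exists_equiv_outerTprod fun o => ρ (some o)
  let assoc := (TensorProduct.assoc k (V none) (V (some none)) (⨂[k] j, V (some (some j)))).symm
  refine ⟨e.trans ((f.lTensor (V none)).trans assoc), fun g δ x => ?_⟩
  have equivariant_lTensor : f.toLinearMap.lTensor (V none) ∘ₗ
      TensorProduct.map (ρ none g) (piTprod (fun o => ρ (some o)) fun o => o.elim g δ) =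
        TensorProduct.map (ρ none g) (outerTprod (ρ (some none))
          (piTprod fun j => ρ (some (some j))) (g, δ)) ∘ₗ f.toLinearMap.lTensor (V none) := by
    rw [LinearMap.lTensor_comp_map, LinearMap.map_comp_lTensor]
    exact congrArg _ (LinearMap.ext (hf _))
  refine (congrArg (assoc ∘ f.lTensor (V none)) (he _ x)).trans ?_
  exact (congrArg assoc (LinearMap.congr_fun equivariant_lTensor (e x))).trans
    (TensorProduct.map_map_assoc_symm _ _ _ _).symm

end OuterTprod

section Intertwining

variable {k M M' V V' W W' : Type*} [Field k] [Monoid M] [Monoid M'] [AddCommGroup V] [Module k V]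
  [AddCommGroup V'] [Module k V'] [AddCommGroup W] [Module k W] [AddCommGroup W'] [Module k W']
  {ρ : Representation k M V} {ρ' : Representation k M' V'} {τ : Representation k M W}
  {τ' : Representation k M' W'}

/-- Intertwining maps may be transported along linear isomorphisms which are equivariant along a
surjective homomorphism of monoids. -/
def intertwiningMapEquiv {φ : M →* M'} (hφ : Function.Surjective φ) (e : V ≃ₗ[k] V')
    (he : ∀ m x, e (ρ m x) = ρ' (φ m) (e x)) (f : W ≃ₗ[k] W')
    (hf : ∀ m x, f (τ m x) = τ' (φ m) (f x)) :
    ρ.IntertwiningMap τ ≃ₗ[k] ρ'.IntertwiningMap τ' where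
  toFun d :=
    { toLinearMap := f.toLinearMap ∘ₗ d.toLinearMap ∘ₗ e.symm.toLinearMap
      isIntertwining' := hφ.forall.2 fun m => by
        ext x
        have he' : e.symm (ρ' (φ m) x) = ρ m (e.symm x) := by
          rw [LinearEquiv.symm_apply_eq, he, LinearEquiv.apply_symm_apply]
        simp [he', hf, d.isIntertwining] }
  invFun d :=
    { toLinearMap := f.symm.toLinearMap ∘ₗ d.toLinearMap ∘ₗ e.toLinearMap
      isIntertwining' := fun m => by
        ext x
        have hf' : f.symm (τ' (φ m) (d (e x))) = τ m (f.symm (d (e x))) := by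
          rw [LinearEquiv.symm_apply_eq, hf, LinearEquiv.apply_symm_apply]
        simp [he, hf', d.isIntertwining] }
  map_add' d d' := by ext; simp
  map_smul' c d := by ext; simp
  left_inv d := by ext; simp
  right_inv d := by ext; simp

end Intertwining

section OuterTprodHom

variable {k : Type*} [Field k] {G Γ X U R T : Type*} [Monoid G] [Monoid Γ]
  [AddCommGroup X] [Module k X] [AddCommGroup U] [Module k U] [AddCommGroup R] [Module k R]
  [AddCommGroup T] [Module k T]

/- Burnside makes the map commute with all operators on `R`; applying this to the operator
`r' ↦ ξ r' • r` shows that `d (x ⊗ r)` is determined by `d (x ⊗ r₀)`, where `ξ r₀ = 1`. -/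
theorem exists_eq_rTensor [IsAlgClosed k] [FiniteDimensional k R] (a : Representation k Γ R)
    [a.IsIrreducible] (d : X ⊗[k] R →ₗ[k] U ⊗[k] R)
    (hd : ∀ γ, d ∘ₗ (a γ).lTensor X = (a γ).lTensor U ∘ₗ d) :
    ∃ φ : X →ₗ[k] U, d = φ.rTensor R := by
  have hd' (S : R →ₗ[k] R) : d ∘ₗ S.lTensor X = S.lTensor U ∘ₗ d := by
    have hS : S ∈ Submodule.span k (Set.range a) := by
      rw [span_range_eq_top_of_isIrreducible]
      trivial
    induction hS using Submodule.span_induction with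
    | mem S hS =>
      obtain ⟨γ, rfl⟩ := hS
      exact hd γ
    | zero => simp
    | add S S' _ _ h h' => rw [LinearMap.lTensor_add, LinearMap.lTensor_add, LinearMap.comp_add,
        LinearMap.add_comp, h, h']
    | smul c S _ h => rw [LinearMap.lTensor_smul, LinearMap.lTensor_smul, LinearMap.comp_smul,
        LinearMap.smul_comp, h]
  have := nontrivial_of_isIrreducible a
  obtain ⟨r₀, hr₀⟩ := exists_ne (0 : R)
  obtain ⟨ξ, hξ⟩ := Module.Projective.exists_dual_eq_one k hr₀
  let slice : U ⊗[k] R →ₗ[k] U := (TensorProduct.rid k U).toLinearMap ∘ₗ ξ.lTensor U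
  have slice_tmul (z : U ⊗[k] R) (r : R) : (ξ.smulRight r).lTensor U z = slice z ⊗ₜ r := by
    induction z using TensorProduct.induction_on with
    | zero => simp
    | tmul u r' => simp [slice, TensorProduct.smul_tmul]
    | add z w hz hw => simp only [map_add, hz, hw, TensorProduct.add_tmul]
  refine ⟨slice ∘ₗ d ∘ₗ (TensorProduct.mk k X R).flip r₀, ?_⟩
  ext x r
  have h := LinearMap.congr_fun (hd' (ξ.smulRight r)) (x ⊗ₜ r₀)
  simpa [hξ, slice_tmul] using h

/-- Intertwining maps between the first factors, extended to outer tensor products. -/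
noncomputable def outerTprodHom (ρ : Representation k G X) (τ : Representation k G U)
    (a : Representation k Γ R) :
    ρ.IntertwiningMap τ →ₗ[k] (outerTprod ρ a).IntertwiningMap (outerTprod τ a) where
  toFun φ := ⟨φ.toLinearMap.rTensor R, fun p => by ext; simp [φ.isIntertwining]⟩
  map_add' φ ψ := by
    ext : 1
    exact LinearMap.rTensor_add _ _ _
  map_smul' c φ := by
    ext : 1
    exact LinearMap.rTensor_smul _ _ _

theorem rTensor_injective (R : Type*) [AddCommGroup R] [Module k R] [Nontrivial R] :
    Function.Injective (LinearMap.rTensorHom R : (X →ₗ[k] U) →ₗ[k] _) := by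
  rw [injective_iff_map_eq_zero]
  exact fun φ => (Module.FaithfullyFlat.zero_iff_rTensor_zero k R φ).2

theorem bijective_outerTprodHom [IsAlgClosed k] [FiniteDimensional k R]
    (ρ : Representation k G X) (τ : Representation k G U) (a : Representation k Γ R)
    [a.IsIrreducible] : Function.Bijective (outerTprodHom ρ τ a) := by
  have := nontrivial_of_isIrreducible a
  constructor
  · intro φ ψ h
    exact Representation.IntertwiningMap.ext
      (rTensor_injective R (congrArg Representation.IntertwiningMap.toLinearMap h))
  · intro d
    obtain ⟨φ, hφ⟩ := exists_eq_rTensor a d.toLinearMap fun γ => by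
      simpa [LinearMap.lTensor, Module.End.one_eq_id] using d.isIntertwining' (1, γ)
    refine ⟨⟨φ, fun g => rTensor_injective R ?_⟩, Representation.IntertwiningMap.ext hφ.symm⟩
    have h := d.isIntertwining' (g, 1)
    rw [hφ] at h
    simpa [LinearMap.rTensor, Module.End.one_eq_id, ← TensorProduct.map_comp] using h

theorem eq_zero_of_equivariant_left (ρ : Representation k G X) (τ : Representation k G U)
    (h : ∀ φ : ρ.IntertwiningMap τ, φ = 0) (d : X ⊗[k] R →ₗ[k] U ⊗[k] T)
    (hd : ∀ g, d ∘ₗ (ρ g).rTensor R = (τ g).rTensor T ∘ₗ d) : d = 0 := by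
  let b := Module.Free.chooseBasis k T
  let coeff (i) : U ⊗[k] T →ₗ[k] U :=
    Finsupp.lapply i ∘ₗ (TensorProduct.equivFinsuppOfBasisRight b).toLinearMap
  have coeff_rTensor (i) (S : U →ₗ[k] U) : coeff i ∘ₗ S.rTensor T = S ∘ₗ coeff i := by
    ext
    simp [coeff]
  ext x r
  refine (TensorProduct.equivFinsuppOfBasisRight (M := U) b).injective (Finsupp.ext fun i => ?_)
  let φ : ρ.IntertwiningMap τ :=
    ⟨coeff i ∘ₗ d ∘ₗ (TensorProduct.mk k X R).flip r, fun g => by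
      ext x
      have h := LinearMap.congr_fun (coeff_rTensor i (τ g)) (d (x ⊗ₜ r))
      have h' := LinearMap.congr_fun (hd g) (x ⊗ₜ r)
      simp only [LinearMap.coe_comp, Function.comp_apply, LinearMap.flip_apply,
        TensorProduct.mk_apply, LinearMap.rTensor_tmul] at h h' ⊢
      rw [h', h]⟩
  have := congrArg (fun φ => φ x) (h φ)
  simpa [φ, coeff] using this

variable {ι κ : Type*} {V : ι → Type*} {W : κ → Type*} [∀ i, AddCommGroup (V i)]
  [∀ i, Module k (V i)] [∀ j, AddCommGroup (W j)] [∀ j, Module k (W j)]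

theorem exists_equiv_rTensor_mulSingle [DecidableEq ι] (ρ : ∀ i, Representation k G (V i))
    (i₀ : ι) : ∃ f : (⨂[k] i, V i) ≃ₗ[k] V i₀ ⊗[k] (⨂[k] j : {j // j ≠ i₀}, V j),
      ∀ g x, f (piTprod ρ (Pi.mulSingle i₀ g) x) = (ρ i₀ g).rTensor _ (f x) := by
  obtain ⟨e, he⟩ := exists_equiv_piTprod (τ := ρ)
    (ρ := fun i => ρ (Equiv.optionSubtypeNe i₀ i)) (Equiv.optionSubtypeNe i₀)
    fun i => Representation.Equiv.refl _
  obtain ⟨f, hf⟩ := exists_equiv_outerTprod fun i => ρ (Equiv.optionSubtypeNe i₀ i)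
  have h_some (g : G) :
      (fun j => (Pi.mulSingle i₀ g ∘ Equiv.optionSubtypeNe i₀) (some j)) = fun _ => 1 := by
    ext j
    simp [j.2]
  have h_none (g : G) : (Pi.mulSingle i₀ g ∘ Equiv.optionSubtypeNe i₀) none = g := by simp
  refine ⟨e.trans f, fun g x => ((congrArg f (he _ x)).trans (hf _ (e x))).trans ?_⟩
  rw [h_some, h_none, outerTprod_apply]
  exact congrArg (fun S => TensorProduct.map (ρ i₀ g) S (f (e x))) (map_one _)

theorem piTprod_hom_eq_zero [DecidableEq ι] [DecidableEq κ] {ρ : ∀ i, Representation k G (V i)}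
    {τ : ∀ j, Representation k G (W j)} {i₀ : ι} {j₀ : κ}
    (h : ∀ φ : (ρ i₀).IntertwiningMap (τ j₀), φ = 0) {d : (⨂[k] i, V i) →ₗ[k] ⨂[k] j, W j}
    (hd : ∀ g x, d (piTprod ρ (Pi.mulSingle i₀ g) x) = piTprod τ (Pi.mulSingle j₀ g) (d x)) :
    d = 0 := by
  obtain ⟨e, he⟩ := exists_equiv_rTensor_mulSingle ρ i₀
  obtain ⟨f, hf⟩ := exists_equiv_rTensor_mulSingle τ j₀
  have conj_eq_zero : f.toLinearMap ∘ₗ d ∘ₗ e.symm.toLinearMap = 0 :=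
    eq_zero_of_equivariant_left (ρ i₀) (τ j₀) h _ fun g => by
      refine LinearMap.ext fun z => ?_
      obtain ⟨x, rfl⟩ := e.surjective z
      simp [← he, hd, hf]
  refine LinearMap.ext fun x => ?_
  simpa using LinearMap.congr_fun conj_eq_zero (e x)

end OuterTprodHom

section TracePairing

variable {k : Type*} [Field k] {G : Type*} [Group G] [Finite G]
  {V W : Type*} [AddCommGroup V] [Module k V] [AddCommGroup W] [Module k W]
  [FiniteDimensional k W] {ρ : Representation k G V} {τ : Representation k G W}

theorem exists_trace_comp_ne_zero (hG : (Nat.card G : k) ≠ 0) {f : ρ.IntertwiningMap τ}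
    (hf : f ≠ 0) : ∃ h : τ.IntertwiningMap ρ,
      LinearMap.trace k W (f.toLinearMap ∘ₗ h.toLinearMap) ≠ 0 := by
  have := Fintype.ofFinite G
  obtain ⟨x, hx⟩ : ∃ x, f x ≠ 0 := by
    by_contra! H
    exact hf (DFunLike.ext _ _ H)
  obtain ⟨ξ, hξ⟩ := Module.Projective.exists_dual_eq_one k hx
  let h₀ : W →ₗ[k] V := ξ.smulRight x
  have trace_h₀ : LinearMap.trace k W (f.toLinearMap ∘ₗ h₀) = 1 := by
    have : f.toLinearMap ∘ₗ h₀ = ξ.smulRight (f x) := by ext; simp [h₀]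
    rw [this, LinearMap.trace_smulRight, hξ]
  let h : τ.IntertwiningMap ρ :=
    ⟨∑ g : G, ρ g ∘ₗ h₀ ∘ₗ τ g⁻¹, fun g => by
      ext w
      simp only [LinearMap.comp_apply, LinearMap.sum_apply, map_sum]
      refine Fintype.sum_equiv (Equiv.mulLeft g⁻¹) _ _ fun g' => ?_
      simp [← Module.End.mul_apply, ← map_mul]⟩
  have trace_summand (g : G) :
      LinearMap.trace k W (f.toLinearMap ∘ₗ ρ g ∘ₗ h₀ ∘ₗ τ g⁻¹) = 1 := by
    have e : f.toLinearMap ∘ₗ ρ g ∘ₗ h₀ ∘ₗ τ g⁻¹ = τ g * ((f.toLinearMap ∘ₗ h₀) * τ g⁻¹) := by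
      rw [← LinearMap.comp_assoc, f.isIntertwining']
      rfl
    rw [e, LinearMap.trace_mul_comm, mul_assoc, ← map_mul, inv_mul_cancel, map_one, mul_one,
      trace_h₀]
  have comp_h : f.toLinearMap ∘ₗ h.toLinearMap = ∑ g : G, f.toLinearMap ∘ₗ ρ g ∘ₗ h₀ ∘ₗ τ g⁻¹ := by
    ext w
    simp [h]
  refine ⟨h, ?_⟩
  rw [comp_h, map_sum, Finset.sum_congr rfl fun g _ => trace_summand g]
  simpa using hG

variable [FiniteDimensional k V]

theorem finrank_intertwiningMap_le (hG : (Nat.card G : k) ≠ 0) :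
    Module.finrank k (ρ.IntertwiningMap τ) ≤ Module.finrank k (τ.IntertwiningMap ρ) := by
  let F : ρ.IntertwiningMap τ →ₗ[k] Module.Dual k (τ.IntertwiningMap ρ) :=
    LinearMap.mk₂ k (fun f h => LinearMap.trace k W (f.toLinearMap ∘ₗ h.toLinearMap))
      (by intro f f' h; rw [← map_add]; rfl)
      (by intro c f h; rw [← map_smul]; rfl)
      (by intro f h h'; rw [← map_add, ← LinearMap.comp_add]; rfl)
      (by intro c f h; rw [← map_smul, ← LinearMap.comp_smul]; rfl)
  have hF : Function.Injective F := by
    rw [injective_iff_map_eq_zero]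
    intro f hf
    by_contra hne
    obtain ⟨h, hh⟩ := exists_trace_comp_ne_zero hG hne
    exact hh (LinearMap.congr_fun hf h)
  exact (LinearMap.finrank_le_finrank_of_injective hF).trans_eq Subspace.dual_finrank_eq

theorem finrank_intertwiningMap_comm (hG : (Nat.card G : k) ≠ 0) (ρ : Representation k G V)
    (τ : Representation k G W) :
    Module.finrank k (ρ.IntertwiningMap τ) = Module.finrank k (τ.IntertwiningMap ρ) :=
  (finrank_intertwiningMap_le hG).antisymm (finrank_intertwiningMap_le hG)

end TracePairing

/-! ### Simple modules as irreducible representations -/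

namespace SimpleClass

section Ring

variable {A : Type w} [Ring A]

instance (S : SimpleClass A) : IsSimpleModule A S.rep :=
  (Quotient.out S).2

theorem eq_of_equiv {S T : SimpleClass A} (e : S.rep ≃ₗ[A] T.rep) : S = T := by
  rw [← Quotient.out_eq S, ← Quotient.out_eq T]
  exact Quotient.sound ⟨e⟩

/-- The isomorphism class of a simple module. -/
def mk (X : Type w) [AddCommGroup X] [Module A X] [IsSimpleModule A X] : SimpleClass A :=
  Quotient.mk (simpleModuleSetoid A) ⟨ModuleCat.of A X, ‹_›⟩

theorem nonempty_rep_mk_equiv (X : Type w) [AddCommGroup X] [Module A X] [IsSimpleModule A X] :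
    Nonempty ((mk (A := A) X).rep ≃ₗ[A] X) :=
  Quotient.mk_out (s := simpleModuleSetoid A) ⟨ModuleCat.of A X, ‹_›⟩

end Ring

section Representation

variable {k : Type u} [Field k] {M : Type v} [Monoid M]

noncomputable instance (S : SimpleClass (MonoidAlgebra k M)) : Module k S.rep :=
  Module.restrictScalars k (MonoidAlgebra k M) S.rep

instance (S : SimpleClass (MonoidAlgebra k M)) : IsScalarTower k (MonoidAlgebra k M) S.rep :=
  IsScalarTower.restrictScalars k (MonoidAlgebra k M) S.rep

/-- A simple module over a monoid algebra, as a representation of the monoid. -/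
noncomputable def rho (S : SimpleClass (MonoidAlgebra k M)) : Representation k M S.rep :=
  Representation.ofModule' S.rep

instance (S : SimpleClass (MonoidAlgebra k M)) : (rho S).IsIrreducible :=
  (Representation.isSimpleModule_iff_irreducible_ofModule (k := k) (G := M) S.rep).1 inferInstance

variable {V : Type max u v} [AddCommGroup V] [Module k V]

theorem nonempty_linearEquiv_iff (S : SimpleClass (MonoidAlgebra k M))
    (ρ : Representation k M V) :
    Nonempty (S.rep ≃ₗ[MonoidAlgebra k M] ρ.asModule) ↔ Nonempty (S.rho.Equiv ρ) := by
  constructor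
  · rintro ⟨e⟩
    refine ⟨.mk ((e.restrictScalars k).trans ρ.asModuleEquiv) fun m => LinearMap.ext fun x => ?_⟩
    have h := e.map_smul (MonoidAlgebra.single m 1) x
    rw [single_smul_eq, one_smul] at h
    exact h
  · rintro ⟨e⟩
    refine ⟨{ e.toLinearEquiv.toAddEquiv with map_smul' := fun r x => ?_ }⟩
    change ρ.asModuleEquiv.symm (e (r • x)) = r • ρ.asModuleEquiv.symm (e x)
    induction r using MonoidAlgebra.induction_linear with
    | zero => simp only [zero_smul, map_zero]
    | add r s hr hs => simp only [add_smul, map_add, hr, hs]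
    | single m c =>
      have hc : MonoidAlgebra.single m c • x = c • S.rho m x :=
        (congrArg (· • x) (by simp)).trans (smul_assoc c (MonoidAlgebra.single m (1 : k)) x)
      rw [hc, single_smul_eq, map_smul]
      exact congrArg (fun y => ρ.asModuleEquiv.symm (c • y)) (e.isIntertwining _ _ m x)

theorem eq_of_rho_equiv {S T : SimpleClass (MonoidAlgebra k M)} (e : S.rho.Equiv T.rho) :
    S = T := by
  obtain ⟨f⟩ := (S.nonempty_linearEquiv_iff T.rho).2 ⟨e⟩
  obtain ⟨f'⟩ := (T.nonempty_linearEquiv_iff T.rho).2 ⟨.refl T.rho⟩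
  exact eq_of_equiv (f.trans f'.symm)

theorem eq_of_intertwiningMap_ne_zero {S T : SimpleClass (MonoidAlgebra k M)}
    {f : S.rho.IntertwiningMap T.rho} (hf : f ≠ 0) : S = T :=
  eq_of_rho_equiv <| f.ofBijective <|
    (Representation.IsIrreducible.bijective_or_eq_zero f).resolve_right hf

theorem exists_rho_equiv (ρ : Representation k M V) [ρ.IsIrreducible] :
    ∃ S : SimpleClass (MonoidAlgebra k M), Nonempty (S.rho.Equiv ρ) := by
  have := ρ.irreducible_iff_isSimpleModule_asModule.1 inferInstance
  exact ⟨mk ρ.asModule, (nonempty_linearEquiv_iff _ ρ).1 (nonempty_rep_mk_equiv ρ.asModule)⟩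

end Representation

end SimpleClass

theorem span_simple_submodules_eq_top (k R X : Type*) [Field k] [Ring R] [AddCommGroup X]
    [Module R X] [Module k X] [IsSemisimpleModule R X] :
    Submodule.span k {x : X | ∃ L : Submodule R X, IsSimpleModule R L ∧ x ∈ L} = ⊤ := by
  refine Submodule.eq_top_iff'.2 fun x => ?_
  have hx : x ∈ sSup {L : Submodule R X | IsSimpleModule R L} := by
    rw [IsSemisimpleModule.sSup_simples_eq_top]
    trivial
  rw [sSup_eq_iSup'] at hx
  induction hx using Submodule.iSup_induction' with
  | mem L x hx => exact Submodule.subset_span ⟨L.1, L.2, hx⟩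
  | zero => exact zero_mem _
  | add x y _ _ hx hy => exact add_mem hx hy

namespace Irr

variable {k : Type u} [Field k] {G : Type v} [Group G]

instance [Finite G] (V : Irr k G) : FiniteDimensional k V.rep := by
  have := IsSimpleModule.nontrivial (MonoidAlgebra k G) V.rep
  obtain ⟨x, hx⟩ := exists_ne (0 : V.rep)
  have : FiniteDimensional k (MonoidAlgebra k G) :=
    Module.Finite.equiv (MonoidAlgebra.coeffLinearEquiv k (S := k) (M := G)).symm
  exact Module.Finite.of_surjective
    ((LinearMap.toSpanSingleton (MonoidAlgebra k G) V.rep x).restrictScalars k)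
    (IsSimpleModule.toSpanSingleton_surjective (MonoidAlgebra k G) hx)

section Power

variable {ι : Type*} [Finite ι] {N : Type*} [AddCommGroup N] [Module k N]
  (τ : Representation k (ι → G) N) (y : N)

/-- The orbit map `γ ↦ τ γ y` of a representation of a power of `G`, extended to the tensor power
of the regular representation of `G`. -/
noncomputable def orbitMap : (⨂[k] _ : ι, MonoidAlgebra k G) →ₗ[k] N :=
  (Basis.piTensorProduct fun _ : ι => MonoidAlgebra.basis G k).constr k fun γ => τ γ y

theorem orbitMap_tprod_single (γ : ι → G) :
    orbitMap τ y (PiTensorProduct.tprod k fun i => MonoidAlgebra.single (γ i) 1) = τ γ y := by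
  have h := (Basis.piTensorProduct fun _ : ι => MonoidAlgebra.basis G k).constr_basis k
    (fun γ => τ γ y) γ
  rwa [Basis.piTensorProduct_apply] at h

theorem orbitMap_map_mulLeft (γ : ι → G) (x : ⨂[k] _ : ι, MonoidAlgebra k G) :
    orbitMap τ y (PiTensorProduct.map
      (fun i => LinearMap.mulLeft k (MonoidAlgebra.single (γ i) (1 : k))) x) =
      τ γ (orbitMap τ y x) := by
  have h : orbitMap τ y ∘ₗ PiTensorProduct.map
      (fun i => LinearMap.mulLeft k (MonoidAlgebra.single (γ i) (1 : k))) =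
      τ γ ∘ₗ orbitMap τ y := by
    refine (Basis.piTensorProduct fun _ : ι => MonoidAlgebra.basis G k).ext fun δ => ?_
    simp only [Basis.piTensorProduct_apply, MonoidAlgebra.basis_apply, LinearMap.comp_apply,
      PiTensorProduct.map_tprod, LinearMap.mulLeft_apply, MonoidAlgebra.single_mul_single, one_mul,
      orbitMap_tprod_single]
    exact LinearMap.congr_fun (map_mul τ γ δ) y
  exact LinearMap.congr_fun h x

theorem exists_orbitMap_comp_ne_zero [Finite G] (hG : (Nat.card G : k) ≠ 0) (hy : y ≠ 0) :
    ∃ (V : ι → Irr k G) (ψ : ∀ i, (V i).rep →ₗ[MonoidAlgebra k G] MonoidAlgebra k G),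
      orbitMap τ y ∘ₗ PiTensorProduct.map (fun i => (ψ i).restrictScalars k) ≠ 0 := by
  have : NeZero (Nat.card G : k) := ⟨hG⟩
  have horbit : orbitMap τ y ≠ 0 := fun h => hy <| by
    have := orbitMap_tprod_single τ y 1
    rwa [h, LinearMap.zero_apply, map_one, Module.End.one_apply, eq_comm] at this
  by_contra! hzero
  have hspan := span_simple_submodules_eq_top k (MonoidAlgebra k G) (MonoidAlgebra k G)
  rw [← Subtype.range_coe (s := {_x | _})] at hspan
  refine horbit (PiTensorProduct.ext_of_span_eq_top (fun _ => hspan) fun a => ?_)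
  choose L hL ha using fun i => (a i).2
  let f (i : ι) := (SimpleClass.nonempty_rep_mk_equiv (A := MonoidAlgebra k G) (L i)).some
  have h := LinearMap.congr_fun (hzero _ fun i => (L i).subtype ∘ₗ (f i).toLinearMap)
    (PiTensorProduct.tprod k fun i => (f i).symm ⟨a i, ha i⟩)
  simpa using h

/- The tensor power of the regular representation maps onto `τ` through an orbit map, and the
regular representation is a sum of irreducible ones. -/
theorem exists_piTprod_equiv [Finite G] [IsAlgClosed k] (hG : (Nat.card G : k) ≠ 0)
    [τ.IsIrreducible] :
    ∃ V : ι → Irr k G, Nonempty ((piTprod fun i => (V i).rho).Equiv τ) := by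
  have := nontrivial_of_isIrreducible τ
  obtain ⟨y, hy⟩ := exists_ne (0 : N)
  obtain ⟨V, ψ, hψ⟩ := exists_orbitMap_comp_ne_zero τ y hG hy
  let f : (piTprod fun i => (V i).rho).IntertwiningMap τ :=
    { toLinearMap := orbitMap τ y ∘ₗ PiTensorProduct.map fun i => (ψ i).restrictScalars k
      isIntertwining' γ := PiTensorProduct.ext (MultilinearMap.ext fun v => by
        have hψ (i : ι) : ψ i ((V i).rho (γ i) (v i)) =
            MonoidAlgebra.single (γ i) 1 * ψ i (v i) :=
          (ψ i).map_smul _ _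
        simp [hψ, ← orbitMap_map_mulLeft]) }
  have hf : f ≠ 0 := fun h => hψ (congrArg Representation.IntertwiningMap.toLinearMap h)
  exact ⟨V, ⟨f.ofBijective <|
    (Representation.IsIrreducible.bijective_or_eq_zero f).resolve_right hf⟩⟩

end Power

end Irr

/-! ### The modules `S_P` -/

namespace LabelledSetPartition

section Relabel

variable {n : ℕ} {X : Type*} {Y : Type w} (P : LabelledSetPartition n X) (V : P.Block → Y)

/-- The labelled set partition with the blocks of `P` and the labels `V`. -/
def relabel : LabelledSetPartition n Y where
  carrier := Set.range fun B : P.Block => (B.1, V B)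
  nonempty := by
    rintro _ ⟨B, rfl⟩
    exact P.nonempty _ (P.label_mem B)
  disjoint := by
    rintro _ ⟨B, rfl⟩ _ ⟨C, rfl⟩ hne
    refine Finset.disjoint_left.2 fun x hB hC => hne ?_
    rw [← mem_block_iff.1 hB, mem_block_iff.1 hC]
  cover x := ⟨_, ⟨P.blockOf x, rfl⟩, P.mem_blockOf x⟩

/-- Relabelling does not change the blocks. -/
def relabelBlock : P.Block ≃ (P.relabel V).Block where
  toFun B := ⟨B.1, V B, B, rfl⟩
  invFun B := ⟨B.1, by
    obtain ⟨x, C, h⟩ := B.2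
    have hC : C.1 = B.1 := congrArg Prod.fst h
    exact hC ▸ C.2⟩
  left_inv _ := rfl
  right_inv _ := rfl

theorem label_relabelBlock (B : P.Block) :
    (P.relabel V).label (P.relabelBlock V B) = V B :=
  label_eq _ _ ⟨B, rfl⟩

theorem relabelBlock_blockOf (x : Fin n) :
    P.relabelBlock V (P.blockOf x) = (P.relabel V).blockOf x :=
  (mem_block_iff (B := P.relabelBlock V (P.blockOf x)).1 (P.mem_blockOf x)).symm

theorem refines_relabel {G : Type v} {σ : OrderedGPartition n G} :
    (P.relabel V).Refines σ ↔ P.Refines σ := by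
  simp only [refines_iff, ← relabelBlock_blockOf, EmbeddingLike.apply_eq_iff_eq]

theorem value_relabelBlock {G : Type v} {σ : OrderedGPartition n G}
    (h : (P.relabel V).Refines σ) (h' : P.Refines σ) (B : P.Block) :
    h.value (P.relabelBlock V B) = h'.value B := by
  obtain ⟨x, rfl⟩ := P.blockOf_surjective B
  rw [relabelBlock_blockOf, h.value_blockOf, h'.value_blockOf]

end Relabel

variable {k : Type u} [Field k] {G : Type v} [Group G] {n : ℕ} [NeZero n]

section Rho

variable (P : LabelledSetPartition n (Irr k G))

/-- The representation `S_P`. -/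
noncomputable def rho :
    Representation k (OrderedGPartition n G) (⨂[k] B : P.Block, (P.label B).rep) :=
  P.action

/-- The outer tensor product of the labels of `P`, a representation of the group of functions on
the blocks of `P`. -/
noncomputable abbrev labelTprod :
    Representation k (P.Block → G) (⨂[k] B : P.Block, (P.label B).rep) :=
  piTprod fun B => (P.label B).rho

variable {P} {σ : OrderedGPartition n G}

theorem rho_of_refines (h : P.Refines σ) : P.rho σ = P.labelTprod h.value :=
  dif_pos h

theorem rho_of_not_refines (h : ¬ P.Refines σ) : P.rho σ = 0 :=
  dif_neg h

theorem rho_eq_labelTprod (h : P.Refines σ) {γ : P.Block → G}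
    (hγ : ∀ x, σ.labelAt x = γ (P.blockOf x)) : P.rho σ = P.labelTprod γ := by
  rw [rho_of_refines h]
  congr 1
  funext B
  obtain ⟨x, rfl⟩ := P.blockOf_surjective B
  rw [h.value_blockOf, hγ]

theorem rho_ordered (γ : P.Block → G) : P.rho (P.ordered γ) = P.labelTprod γ :=
  rho_eq_labelTprod (P.refines_ordered γ) (P.labelAt_ordered γ)

theorem rho_eq_one_of_labelAt_eq_one (h : P.Refines σ) (hσ : ∀ x, σ.labelAt x = 1) :
    P.rho σ = 1 := by
  rw [rho_eq_labelTprod (γ := 1) h hσ, map_one]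

theorem rho_front (B : P.Block) (g : G) :
    P.rho (.front B.1 g) = P.labelTprod (Pi.mulSingle B g) :=
  rho_eq_labelTprod (refines_front B g) fun x => by
    simp only [OrderedGPartition.labelAt_front, Pi.mulSingle_apply, mem_block_iff]

theorem rho_front_one (B : P.Block) : P.rho (.front B.1 1) = 1 :=
  P.rho_eq_one_of_labelAt_eq_one (refines_front B 1) OrderedGPartition.labelAt_front_one

theorem hom_eq_zero_of_label_ne {Q : LabelledSetPartition n (Irr k G)}
    {B : P.Block} {C : Q.Block} (hBC : B.1 = C.1) (hne : P.label B ≠ Q.label C)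
    {d : (⨂[k] B, (P.label B).rep) →ₗ[k] ⨂[k] B, (Q.label B).rep}
    (hd : ∀ g z, d (P.rho (.front B.1 g) z) = Q.rho (.front B.1 g) (d z)) : d = 0 := by
  classical
  refine piTprod_hom_eq_zero (ρ := fun B => (P.label B).rho) (τ := fun B => (Q.label B).rho)
    (i₀ := B) (j₀ := C) (fun φ => ?_) fun g z => ?_
  · by_contra hφ
    exact hne (SimpleClass.eq_of_intertwiningMap_ne_zero hφ)
  · have := hd g z
    rwa [rho_front, hBC, rho_front] at this

variable (P)

instance [Finite G] [IsAlgClosed k] : P.rho.IsIrreducible :=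
  isIrreducible_of_mem_span_range P.labelTprod fun γ =>
    Submodule.subset_span ⟨P.ordered γ, rho_ordered γ⟩

end Rho

section Injective

variable [Finite G] [IsAlgClosed k] {P Q : LabelledSetPartition n (Irr k G)}

theorem Refines.of_rho_equiv (e : P.rho.Equiv Q.rho) {σ : OrderedGPartition n G}
    (h : P.Refines σ) : Q.Refines σ := by
  by_contra hQ
  have hP : P.rho σ.unlabel = 1 :=
    rho_eq_one_of_labelAt_eq_one (refines_unlabel.2 h) σ.labelAt_unlabel
  have hQ : Q.rho σ.unlabel = 0 := rho_of_not_refines (refines_unlabel.not.2 hQ)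
  have := nontrivial_of_isIrreducible P.rho
  obtain ⟨x, hx⟩ := exists_ne (0 : ⨂[k] B, (P.label B).rep)
  have hex := e.isIntertwining _ _ σ.unlabel x
  rw [hP, hQ] at hex
  exact hx (e.toLinearEquiv.map_eq_zero_iff.1 hex)

theorem eq_of_rho_equiv (e : P.rho.Equiv Q.rho) : P = Q := by
  have hblock (x y : Fin n) : P.blockOf x = P.blockOf y ↔ Q.blockOf x = Q.blockOf y := by
    constructor
    · intro h
      have := (Q.refines_ordered (1 : Q.Block → G)).of_rho_equiv e.symm
      exact (Q.rank_ordered_eq_iff _).1 (this.rank_eq h)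
    · intro h
      have := (P.refines_ordered (1 : P.Block → G)).of_rho_equiv e
      exact (P.rank_ordered_eq_iff _).1 (this.rank_eq h)
  refine ext_blockOf hblock fun x => ?_
  by_contra hne
  have hBC : (P.blockOf x).1 = (Q.blockOf x).1 := by
    ext y
    rw [mem_block_iff, mem_block_iff, hblock]
  have he := hom_eq_zero_of_label_ne (d := e.toLinearMap) hBC hne fun g z =>
    e.isIntertwining _ _ _ z
  have := nontrivial_of_isIrreducible P.rho
  obtain ⟨z, hz⟩ := exists_ne (0 : ⨂[k] B, (P.label B).rep)
  exact hz (e.toLinearEquiv.map_eq_zero_iff.1 (LinearMap.congr_fun he z))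

end Injective

end LabelledSetPartition

section Surjective

variable {n : ℕ} {G : Type v}

/-- The `G`-labelled set partition obtained from `σ` by forgetting the order of the blocks. -/
def OrderedGPartition.forgetOrder (σ : OrderedGPartition n G) : LabelledSetPartition n G where
  carrier := {p | p ∈ σ.parts}
  nonempty := σ.nonempty
  disjoint _ hp _ hq hne := Finset.disjoint_left.2 fun _ hx hx' => hne (σ.eq_of_mem hp hq hx hx')
  cover := σ.cover

theorem OrderedGPartition.blockOf_forgetOrder_eq_iff (σ : OrderedGPartition n G) {x y : Fin n} :
    σ.forgetOrder.blockOf x = σ.forgetOrder.blockOf y ↔ σ.rank x = σ.rank y := by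
  rw [σ.rank_eq_rank_iff, ← LabelledSetPartition.mem_block_iff]
  constructor
  · intro h
    exact ⟨_, σ.forgetOrder.label_mem _, h, LabelledSetPartition.mem_blockOf _ y⟩
  · rintro ⟨p, hp, hx, hy⟩
    have hB : σ.forgetOrder.blockOf y = ⟨p.1, p.2, hp⟩ := LabelledSetPartition.mem_block_iff.1 hy
    exact hB ▸ hx

theorem OrderedGPartition.mul_ordered_forgetOrder [MulOneClass G] (σ : OrderedGPartition n G) :
    σ * σ.forgetOrder.ordered 1 = σ :=
  ext_rank (fun x y => by
    have hrank := σ.forgetOrder.rank_ordered_eq_iff (1 : σ.forgetOrder.Block → G) (x := x) (y := y)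
    rw [σ.blockOf_forgetOrder_eq_iff] at hrank
    simp only [rank_mul_lt_iff]
    grind) (by simp)

namespace LabelledSetPartition

variable {k : Type u} [Field k] [Group G] [NeZero n] {N : Type*} [AddCommGroup N] [Module k N]
  (τ : Representation k (OrderedGPartition n G) N)

/-- The representation of the group of functions on the blocks of `P` on a representation `τ` on
which the blocks of `P`, in any order, act as the identity. -/
noncomputable def restrictOrdered {X : Type*} (P : LabelledSetPartition n X)
    (hP : τ (P.ordered 1) = 1) : Representation k (P.Block → G) N where
  toFun γ := τ (P.ordered γ)
  map_one' := hP
  map_mul' γ δ := by rw [← P.ordered_mul_ordered, map_mul]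

variable [τ.IsIrreducible]

/- The kernel of `τ ε` is stable, because `ε * σ = ε * σ * ε` for all `σ`. -/
theorem map_eq_one_of_labelAt_eq_one {ε : OrderedGPartition n G} (hε : ∀ x, ε.labelAt x = 1)
    (h0 : τ ε ≠ 0) : τ ε = 1 := by
  have hετ (σ : OrderedGPartition n G) (x : N) : τ ε (τ σ x) = τ ε (τ σ (τ ε x)) := by
    simp only [← Module.End.mul_apply, ← map_mul, ← mul_assoc,
      OrderedGPartition.mul_mul_of_labelAt_eq_one σ hε]
  let K : Subrepresentation τ := ⟨LinearMap.ker (τ ε), fun σ x hx => by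
    rw [LinearMap.mem_ker] at hx ⊢
    rw [hετ, hx, map_zero, map_zero]⟩
  have hK : LinearMap.ker (τ ε) = ⊥ := by
    rcases eq_bot_or_eq_top K with hbot | htop
    · exact congrArg Subrepresentation.toSubmodule hbot
    · exact absurd (LinearMap.ker_eq_top.1 (congrArg Subrepresentation.toSubmodule htop)) h0
  ext x
  have := hετ 1 x
  rw [map_one] at this
  exact (LinearMap.ker_eq_bot.1 hK this).symm

variable [Finite G]

theorem exists_forall_not_refines_map_eq_zero :
    ∃ P : LabelledSetPartition n G, τ (P.ordered 1) = 1 ∧ ∀ σ, ¬ P.Refines σ → τ σ = 0 := by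
  have := nontrivial_of_isIrreducible τ
  obtain ⟨σ, hσ, hmin⟩ := (Set.toFinite {σ | τ σ ≠ 0}).exists_minimalFor
    (fun σ => {p : Fin n × Fin n | σ.rank p.1 = σ.rank p.2}) _ ⟨1, by simp⟩
  let P := σ.forgetOrder
  have hP0 : τ (P.ordered 1) ≠ 0 := fun h => hσ <| by
    rw [← σ.mul_ordered_forgetOrder, map_mul]
    exact (congrArg (τ σ * ·) h).trans (mul_zero _)
  have hP1 := map_eq_one_of_labelAt_eq_one τ (P.labelAt_ordered 1) hP0
  refine ⟨P, hP1, fun σ' => not_imp_comm.1 fun h0 => refines_iff.2 fun x y hxy => ?_⟩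
  have h0' : P.ordered 1 * σ' ∈ {σ | τ σ ≠ 0} := by
    rwa [Set.mem_ofPred_eq, map_mul, hP1, one_mul]
  have hle := hmin h0' fun p hp => by
    have := (OrderedGPartition.rank_mul_eq_iff _ _).1 hp
    exact σ.blockOf_forgetOrder_eq_iff.1 ((P.rank_ordered_eq_iff 1).1 this.1)
  have hxy' := @hle (x, y) (σ.blockOf_forgetOrder_eq_iff.1 hxy)
  exact ((OrderedGPartition.rank_mul_eq_iff _ _).1 hxy').2

theorem exists_rho_equiv [IsAlgClosed k] (hG : (Nat.card G : k) ≠ 0) :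
    ∃ P : LabelledSetPartition n (Irr k G), Nonempty (P.rho.Equiv τ) := by
  obtain ⟨P, hP1, hP0⟩ := exists_forall_not_refines_map_eq_zero τ
  have hτ {σ} (h : P.Refines σ) : τ σ = restrictOrdered τ P hP1 h.value := by
    rw [← one_mul (τ σ), ← hP1, ← map_mul, h.ordered_one_mul]
    rfl
  have : (restrictOrdered τ P hP1).IsIrreducible := isIrreducible_of_mem_span_range τ fun σ => by
    by_cases h : P.Refines σ
    · exact hτ h ▸ Submodule.subset_span ⟨_, rfl⟩
    · exact hP0 σ h ▸ Submodule.zero_mem _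
  obtain ⟨V, ⟨e⟩⟩ := Irr.exists_piTprod_equiv (restrictOrdered τ P hP1) hG
  have relabelEquiv (B : P.Block) :
      Nonempty (((P.relabel V).label (P.relabelBlock V B)).rho.Equiv (V B).rho) :=
    P.label_relabelBlock V B ▸ ⟨.refl _⟩
  obtain ⟨f, hf⟩ := exists_equiv_piTprod (τ := fun C => ((P.relabel V).label C).rho)
    (ρ := fun B => (V B).rho) (P.relabelBlock V) fun B => (relabelEquiv B).some
  refine ⟨P.relabel V, ⟨.mk (f.trans e.toLinearEquiv) fun σ => LinearMap.ext fun x => ?_⟩⟩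
  change e (f ((P.relabel V).rho σ x)) = τ σ (e (f x))
  by_cases h : P.Refines σ
  · have h' := (P.refines_relabel V).2 h
    have hvalue : h'.value ∘ P.relabelBlock V = h.value :=
      funext (P.value_relabelBlock V h' h)
    rw [rho_of_refines h', hτ h, ← hvalue, hf]
    exact e.isIntertwining _ _ _ _
  · rw [rho_of_not_refines ((P.refines_relabel V).not.2 h), hP0 σ h]
    simp

end LabelledSetPartition

end Surjective

namespace LabelledSetPartition

variable {k : Type u} [Field k] [IsAlgClosed k] {G : Type v} [Group G] [Finite G] {n : ℕ}
  [NeZero n]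

/-- The isomorphism class of the simple module `S_P`. -/
noncomputable def simple (P : LabelledSetPartition n (Irr k G)) :
    SimpleClass (MonoidAlgebra k (OrderedGPartition n G)) :=
  (SimpleClass.exists_rho_equiv P.rho).choose

theorem nonempty_simple_rho_equiv (P : LabelledSetPartition n (Irr k G)) :
    Nonempty (P.simple.rho.Equiv P.rho) :=
  (SimpleClass.exists_rho_equiv P.rho).choose_spec

theorem bijective_simple (hG : (Nat.card G : k) ≠ 0) :
    Function.Bijective (simple : LabelledSetPartition n (Irr k G) → _) := by
  constructor
  · intro P Q hPQ
    obtain ⟨e⟩ := P.nonempty_simple_rho_equiv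
    obtain ⟨f⟩ := Q.nonempty_simple_rho_equiv
    rw [← hPQ] at f
    exact eq_of_rho_equiv (e.symm.trans f)
  · intro S
    obtain ⟨P, ⟨e⟩⟩ := exists_rho_equiv S.rho hG
    obtain ⟨f⟩ := P.nonempty_simple_rho_equiv
    exact ⟨P, SimpleClass.eq_of_rho_equiv (f.trans e)⟩

end LabelledSetPartition

/-! ### Cocycles between the modules `S_P` -/

section Coboundaries

variable {k : Type u} [Field k] {V W : Type*} [AddCommGroup V] [Module k V]
  [AddCommGroup W] [Module k W]

theorem mem_range_coboundary_iff {M : Type v} [Monoid M] {ρ : Representation k M V}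
    {τ : Representation k M W} {c : cocycles ρ τ} :
    c ∈ LinearMap.range (coboundary ρ τ) ↔
      ∃ h : V →ₗ[k] W, ∀ m x, c.1 m x = τ m (h x) - h (ρ m x) := by
  refine exists_congr fun h => ⟨?_, fun hc => ?_⟩
  · rintro rfl m x
    rfl
  · ext m x
    exact (hc m x).symm

/- A cocycle is the coboundary of minus the average of the maps `c δ ∘ ρ δ⁻¹`. -/
theorem mem_range_coboundary_of_card_ne_zero {H : Type v} [Group H] [Finite H]
    (hH : (Nat.card H : k) ≠ 0) {ρ : Representation k H V} {τ : Representation k H W}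
    (c : cocycles ρ τ) : c ∈ LinearMap.range (coboundary ρ τ) := by
  have := Fintype.ofFinite H
  let s : V →ₗ[k] W := ∑ δ, c.1 δ ∘ₗ ρ δ⁻¹
  have hs (γ : H) (x : V) : s (ρ γ x) = τ γ (s x) + (Nat.card H : k) • c.1 γ x := by
    have hterm (δ : H) : c.1 (γ * δ) (ρ (γ * δ)⁻¹ (ρ γ x)) = τ γ (c.1 δ (ρ δ⁻¹ x)) + c.1 γ x := by
      rw [cocycle_mul, ← Module.End.mul_apply, ← map_mul, mul_inv_rev, inv_mul_cancel_right,
        ← Module.End.mul_apply, ← map_mul, mul_inv_cancel, map_one, Module.End.one_apply]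
    simp only [s, LinearMap.sum_apply, LinearMap.comp_apply, map_sum]
    rw [← Equiv.sum_comp (Equiv.mulLeft γ)]
    simp only [Equiv.coe_mulLeft, hterm, Finset.sum_add_distrib, Finset.sum_const,
      Finset.card_univ, Nat.card_eq_fintype_card, Nat.cast_smul_eq_nsmul]
  refine mem_range_coboundary_iff.2 ⟨-((Nat.card H : k)⁻¹ • s), fun γ x => ?_⟩
  simp only [LinearMap.neg_apply, LinearMap.smul_apply, hs, map_neg, map_smul, smul_add,
    inv_smul_smul₀ hH]
  abel

end Coboundaries

namespace LabelledSetPartition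

section Relations

variable {n : ℕ} {X Y : Type*} (P : LabelledSetPartition n X) (Q : LabelledSetPartition n Y)

/-- Every block of `P` lies in a block of `Q`, for labelled set partitions `P` and `Q`. -/
def IsFiner : Prop := ∀ x y, P.blockOf x = P.blockOf y → Q.blockOf x = Q.blockOf y

/-- `x` and `y` lie in the same block of `Q`, but in different blocks of `P`. -/
def Joins (x y : Fin n) : Prop := Q.blockOf x = Q.blockOf y ∧ P.blockOf x ≠ P.blockOf y

/-- The blocks of `Q` arise from those of `P` by merging two different blocks, the ones which
contain `x₀` and `y₀`. -/
structure MergesBlocks (x₀ y₀ : Fin n) : Prop where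
  ne : P.blockOf x₀ ≠ P.blockOf y₀
  blockOf_eq_iff : ∀ x y, Q.blockOf x = Q.blockOf y ↔
    P.blockOf x = P.blockOf y ∨ s(P.blockOf x, P.blockOf y) = s(P.blockOf x₀, P.blockOf y₀)

variable {P Q} {x y x₀ y₀ : Fin n}

theorem Joins.symm (h : P.Joins Q x y) : P.Joins Q y x := ⟨h.1.symm, h.2.symm⟩

theorem IsFiner.refines {G : Type v} (hPQ : P.IsFiner Q) {σ : OrderedGPartition n G}
    (hσ : Q.Refines σ) : P.Refines σ :=
  refines_iff.2 fun x y h => hσ.rank_eq (hPQ x y h)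

theorem Joins.not_refines_front {G : Type v} [One G] (h : P.Joins Q x y) (g : G) :
    ¬ Q.Refines (.front (P.blockOf x).1 g) := fun hQ => by
  have hxy := hQ.rank_eq h.1
  rw [OrderedGPartition.rank_front_eq_iff, mem_block_iff, mem_block_iff] at hxy
  exact h.2 (hxy.1 rfl).symm

theorem Joins.rank_front_lt {G : Type v} [One G] (h : P.Joins Q x y) (g : G) :
    (OrderedGPartition.front (P.blockOf x).1 g).rank x <
      (OrderedGPartition.front (P.blockOf x).1 g).rank y := by
  rw [OrderedGPartition.rank_front_lt_iff, mem_block_iff, mem_block_iff]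
  exact ⟨rfl, h.2.symm⟩

namespace MergesBlocks

variable (hPQ : P.MergesBlocks Q x₀ y₀)
include hPQ

theorem isFiner : P.IsFiner Q := fun x y h => (hPQ.blockOf_eq_iff x y).2 (.inl h)

theorem joins : P.Joins Q x₀ y₀ := ⟨(hPQ.blockOf_eq_iff _ _).2 (.inr rfl), hPQ.ne⟩

theorem eq_or_eq (h : P.Joins Q x y) :
    P.blockOf x = P.blockOf x₀ ∧ P.blockOf y = P.blockOf y₀ ∨
      P.blockOf x = P.blockOf y₀ ∧ P.blockOf y = P.blockOf x₀ :=
  Sym2.eq_iff.1 (((hPQ.blockOf_eq_iff x y).1 h.1).resolve_left h.2)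

theorem blockOf_val_eq (hx : P.blockOf x ≠ P.blockOf x₀) (hy : P.blockOf x ≠ P.blockOf y₀) :
    (P.blockOf x).1 = (Q.blockOf x).1 := by
  ext y
  rw [mem_block_iff, mem_block_iff, hPQ.blockOf_eq_iff, Sym2.eq_iff]
  tauto

theorem refines {G : Type v} {σ : OrderedGPartition n G} (hσ : P.Refines σ)
    (h : σ.rank x₀ = σ.rank y₀) : Q.Refines σ := refines_iff.2 fun x y hxy => by
  by_cases hP : P.blockOf x = P.blockOf y
  · exact hσ.rank_eq hP
  · rcases hPQ.eq_or_eq ⟨hxy, hP⟩ with ⟨hx, hy⟩ | ⟨hx, hy⟩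
    · rw [hσ.rank_eq hx, hσ.rank_eq hy, h]
    · rw [hσ.rank_eq hx, hσ.rank_eq hy, h]

end MergesBlocks

theorem mergesBlocks_of_joins (hPQ : P.IsFiner Q) (h₀ : P.Joins Q x₀ y₀)
    (h : ∀ x y, P.Joins Q x y → s(P.blockOf x, P.blockOf y) = s(P.blockOf x₀, P.blockOf y₀)) :
    P.MergesBlocks Q x₀ y₀ where
  ne := h₀.2
  blockOf_eq_iff x y := by
    refine ⟨fun hxy => or_iff_not_imp_left.2 fun hne => h x y ⟨hxy, hne⟩, ?_⟩
    rintro (hxy | hxy)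
    · exact hPQ x y hxy
    · rcases Sym2.eq_iff.1 hxy with ⟨hx, hy⟩ | ⟨hx, hy⟩
      · rw [hPQ _ _ hx, hPQ _ _ hy, h₀.1]
      · rw [hPQ _ _ hx, hPQ _ _ hy, h₀.1]

end Relations

variable {k : Type u} [Field k] {G : Type v} [Group G] {n : ℕ} [NeZero n]
  {P Q : LabelledSetPartition n (Irr k G)} (c : cocycles P.rho Q.rho)
  {σ τ : OrderedGPartition n G}

theorem cocycle_mul_of_not_refines (hσ : ¬ Q.Refines σ) : c.1 (σ * τ) = c.1 σ ∘ₗ P.rho τ := by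
  refine LinearMap.ext fun x => ?_
  rw [cocycle_mul, Q.rho_of_not_refines hσ, LinearMap.zero_apply, zero_add, LinearMap.comp_apply]

theorem cocycle_mul_of_labelAt_eq_one (hσ : ¬ Q.Refines σ) (hτ : P.Refines τ)
    (h : ∀ x, τ.labelAt x = 1) : c.1 (σ * τ) = c.1 σ := by
  rw [cocycle_mul_of_not_refines c hσ, P.rho_eq_one_of_labelAt_eq_one hτ h]
  rfl

theorem cocycle_eq_zero (hP : ¬ P.Refines σ) (hQ : ¬ Q.Refines σ) : c.1 σ = 0 := by
  rw [← σ.mul_unlabel, cocycle_mul_of_not_refines c hQ,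
    P.rho_of_not_refines (refines_unlabel.not.2 hP), LinearMap.comp_zero]

theorem mem_range_coboundary_of_not_isFiner (hPQ : ¬ P.IsFiner Q) :
    c ∈ LinearMap.range (coboundary P.rho Q.rho) := by
  let ε : OrderedGPartition n G := Q.ordered 1
  have hε : ∀ x, ε.labelAt x = 1 := Q.labelAt_ordered 1
  have hP : P.rho ε = 0 := P.rho_of_not_refines fun h =>
    hPQ fun x y hxy => (Q.rank_ordered_eq_iff 1).1 (h.rank_eq hxy)
  have hQ : Q.rho ε = 1 := Q.rho_eq_one_of_labelAt_eq_one (Q.refines_ordered 1) hε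
  refine mem_range_coboundary_iff.2 ⟨c.1 ε, fun σ x => eq_sub_iff_add_eq.2 ?_⟩
  calc c.1 σ x + c.1 ε (P.rho σ x) = c.1 (ε * σ) x := by
        rw [cocycle_mul, hQ, Module.End.one_apply]
    _ = c.1 (ε * σ * ε) x := by rw [OrderedGPartition.mul_mul_of_labelAt_eq_one σ hε]
    _ = Q.rho σ (c.1 ε x) := by
        rw [cocycle_mul, hP, map_mul, hQ, one_mul, LinearMap.zero_apply, map_zero, add_zero]

theorem mem_range_coboundary_of_blockOf_eq_iff [Finite G] (hG : (Nat.card G : k) ≠ 0)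
    (hPQ : ∀ x y, P.blockOf x = P.blockOf y ↔ Q.blockOf x = Q.blockOf y) :
    c ∈ LinearMap.range (coboundary P.rho Q.rho) := by
  have hrefines (σ : OrderedGPartition n G) : P.Refines σ ↔ Q.Refines σ := by
    simp only [refines_iff, hPQ]
  have hP : P.rho (P.ordered 1) = 1 :=
    P.rho_eq_one_of_labelAt_eq_one (P.refines_ordered 1) (P.labelAt_ordered 1)
  have hQ : Q.rho (P.ordered 1) = 1 :=
    Q.rho_eq_one_of_labelAt_eq_one ((hrefines _).1 (P.refines_ordered 1)) (P.labelAt_ordered 1)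
  let c' : cocycles (restrictOrdered P.rho P hP) (restrictOrdered Q.rho P hQ) :=
    ⟨fun γ => c.1 (P.ordered γ), fun γ δ x => by
      beta_reduce
      rw [← P.ordered_mul_ordered, cocycle_mul]
      rfl⟩
  have hcard : (Nat.card (P.Block → G) : k) ≠ 0 := by
    rw [Nat.card_fun, Nat.cast_pow]
    exact pow_ne_zero _ hG
  obtain ⟨h, hh⟩ := mem_range_coboundary_iff.1 (mem_range_coboundary_of_card_ne_zero hcard c')
  refine mem_range_coboundary_iff.2 ⟨h, fun σ x => ?_⟩
  by_cases hσ : P.Refines σ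
  · have hc : c.1 σ = c.1 (P.ordered hσ.value) := by
      refine LinearMap.ext fun x => ?_
      have h1 : c.1 (P.ordered 1) (P.rho σ x) = 0 := cocycle_one c' _
      rw [← hσ.ordered_one_mul, cocycle_mul, h1, hQ, Module.End.one_apply, add_zero]
    rw [hc, ← one_mul (P.rho σ), ← one_mul (Q.rho σ), ← hP, ← hQ, ← map_mul, ← map_mul,
      hσ.ordered_one_mul]
    exact hh hσ.value x
  · have hσ' := (hrefines σ).not.1 hσ
    simp [cocycle_eq_zero c hσ hσ', P.rho_of_not_refines hσ, Q.rho_of_not_refines hσ']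

variable {c} {x y x' y' x₀ y₀ : Fin n}

/- The ordered partition `s` into `{z | rank z ≤ rank x}` and its complement satisfies `s * σ = σ`
and commutes with the one which puts the block of `x` first; neither is refined by `Q`. -/
theorem cocycle_eq_front (h : P.Joins Q x y) (hσ : P.Refines σ) (hσ' : ∀ z, σ.labelAt z = 1)
    (hxy : σ.rank x < σ.rank y) : c.1 σ = c.1 (.front (P.blockOf x).1 1) := by
  let s : OrderedGPartition n G := .front (Finset.univ.filter fun z => σ.rank z ≤ σ.rank x) 1
  have hsP : P.Refines s := refines_iff.2 fun z w hzw => by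
    simp only [s, OrderedGPartition.rank_front_eq_iff, Finset.mem_filter_univ, hσ.rank_eq hzw]
  have hsQ : ¬ Q.Refines s := fun hs => by
    have := hs.rank_eq h.1
    simp only [s, OrderedGPartition.rank_front_eq_iff, Finset.mem_filter_univ, le_refl] at this
    lia
  have hcomm : s * .front (P.blockOf x).1 1 = .front (P.blockOf x).1 1 * s :=
    OrderedGPartition.front_mul_front_comm fun z hz =>
      (Finset.mem_filter_univ z).2 (hσ.rank_eq (mem_block_iff.1 hz)).le
  calc c.1 σ = c.1 (s * σ) := by rw [OrderedGPartition.front_rank_le_mul]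
    _ = c.1 s := cocycle_mul_of_labelAt_eq_one c hsQ hσ hσ'
    _ = c.1 (s * .front (P.blockOf x).1 1) :=
        (cocycle_mul_of_labelAt_eq_one c hsQ (refines_front _ 1)
          OrderedGPartition.labelAt_front_one).symm
    _ = c.1 (.front (P.blockOf x).1 1) := by
        rw [hcomm, cocycle_mul_of_labelAt_eq_one c (h.not_refines_front 1) hsP
          OrderedGPartition.labelAt_front_one]

theorem cocycle_of_rank_lt (h : P.Joins Q x y) (hσ : P.Refines σ) (hxy : σ.rank x < σ.rank y) :
    c.1 σ = c.1 (.front (P.blockOf x).1 1) ∘ₗ P.rho σ := by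
  have hQ : ¬ Q.Refines σ.unlabel := fun hQ =>
    hxy.ne ((refines_unlabel.1 hQ).rank_eq h.1)
  rw [← cocycle_eq_front h (refines_unlabel.2 hσ) σ.labelAt_unlabel
    (σ.rank_unlabel_lt_iff.2 hxy), ← cocycle_mul_of_not_refines c hQ, σ.unlabel_mul]

theorem cocycle_of_refines (hPQ : P.IsFiner Q) (h : P.Joins Q x y) (hσ : Q.Refines σ) :
    c.1 σ = c.1 (.front (P.blockOf x).1 1) ∘ₗ P.rho σ -
      Q.rho σ ∘ₗ c.1 (.front (P.blockOf x).1 1) := by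
  have hmul : c.1 (σ * .front (P.blockOf x).1 1) =
      c.1 (.front (P.blockOf x).1 1) ∘ₗ P.rho (σ * .front (P.blockOf x).1 1) :=
    cocycle_of_rank_lt h (refines_mul.2 ⟨hPQ.refines hσ, refines_front _ 1⟩)
      ((OrderedGPartition.rank_mul_lt_iff _ _).2 (.inr ⟨hσ.rank_eq h.1, h.rank_front_lt 1⟩))
  refine LinearMap.ext fun z => ?_
  have hz := LinearMap.congr_fun hmul z
  rw [cocycle_mul, map_mul, rho_front_one, mul_one, Module.End.one_apply] at hz
  exact eq_sub_of_add_eq' hz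

theorem mem_range_coboundary_of_front (hPQ : P.IsFiner Q) (h₀ : P.Joins Q x₀ y₀)
    (hc : ∀ x y, P.Joins Q x y →
      c.1 (.front (P.blockOf x).1 1) = c.1 (.front (P.blockOf x₀).1 1)) :
    c ∈ LinearMap.range (coboundary P.rho Q.rho) := by
  refine mem_range_coboundary_iff.2 ⟨-c.1 (.front (P.blockOf x₀).1 1), fun σ z => ?_⟩
  rw [LinearMap.neg_apply, LinearMap.neg_apply, map_neg, sub_neg_eq_add, neg_add_eq_sub]
  by_cases hQ : Q.Refines σ
  · exact LinearMap.congr_fun (cocycle_of_refines hPQ h₀ hQ) z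
  rw [Q.rho_of_not_refines hQ, LinearMap.zero_apply, sub_zero]
  by_cases hP : P.Refines σ
  · obtain ⟨x, y, h, hxy⟩ : ∃ x y, P.Joins Q x y ∧ σ.rank x < σ.rank y := by
      rw [refines_iff] at hQ
      push Not at hQ
      obtain ⟨x, y, h, hxy⟩ := hQ
      have hjoin : P.Joins Q x y := ⟨h, fun h' => hxy (hP.rank_eq h')⟩
      exact hxy.lt_or_gt.elim (fun hlt => ⟨x, y, hjoin, hlt⟩) fun hgt => ⟨y, x, hjoin.symm, hgt⟩
    rw [cocycle_of_rank_lt h hP hxy, hc x y h, LinearMap.comp_apply]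
  · rw [cocycle_eq_zero c hP hQ, P.rho_of_not_refines hP, LinearMap.zero_apply,
      LinearMap.zero_apply, map_zero]

/- Both sides are the value on the ordered partition with the block of `x` first and that of `x'`
second. -/
theorem cocycle_front_eq_of_ne (h : P.Joins Q x y) (h' : P.Joins Q x' y')
    (hne : P.blockOf x ≠ P.blockOf y') :
    c.1 (.front (P.blockOf x).1 1) = c.1 (.front (P.blockOf x').1 1) := by
  let s : OrderedGPartition n G := .front (P.blockOf x).1 1 * .front (P.blockOf x').1 1
  have hs : P.Refines s := refines_mul.2 ⟨refines_front _ 1, refines_front _ 1⟩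
  have hs' (z : Fin n) : s.labelAt z = 1 := by
    rw [OrderedGPartition.labelAt_mul, OrderedGPartition.labelAt_front_one,
      OrderedGPartition.labelAt_front_one, one_mul]
  have hlt : ∀ z w, s.rank z < s.rank w ↔
      (P.blockOf z = P.blockOf x ∧ P.blockOf w ≠ P.blockOf x) ∨
      ((P.blockOf z = P.blockOf x ↔ P.blockOf w = P.blockOf x) ∧
        P.blockOf z = P.blockOf x' ∧ P.blockOf w ≠ P.blockOf x') := fun z w => by
    simp only [s, OrderedGPartition.rank_mul_lt_iff, OrderedGPartition.rank_front_lt_iff,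
      OrderedGPartition.rank_front_eq_iff, mem_block_iff, ne_eq]
  rw [← cocycle_eq_front h hs hs' ((hlt x y).2 (.inl ⟨rfl, h.2.symm⟩)),
    ← cocycle_eq_front h' hs hs' ((hlt x' y').2 ?_)]
  by_cases hx : P.blockOf x' = P.blockOf x
  · exact .inl ⟨hx, hne.symm⟩
  · exact .inr ⟨iff_of_false hx hne.symm, rfl, h'.2.symm⟩

theorem cocycle_front_eq_of_sym2_ne (h : P.Joins Q x y) (h' : P.Joins Q x' y')
    (hne : ¬ (P.blockOf x = P.blockOf y' ∧ P.blockOf y = P.blockOf x')) :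
    c.1 (.front (P.blockOf x).1 1) = c.1 (.front (P.blockOf x').1 1) := by
  by_cases hx : P.blockOf x = P.blockOf y'
  · exact (cocycle_front_eq_of_ne h' h fun hy => hne ⟨hx, hy.symm⟩).symm
  · exact cocycle_front_eq_of_ne h h' hx

theorem mem_range_coboundary_of_joins (hPQ : P.IsFiner Q) (h₀ : P.Joins Q x₀ y₀)
    (h₁ : P.Joins Q x y)
    (hne : s(P.blockOf x, P.blockOf y) ≠ s(P.blockOf x₀, P.blockOf y₀)) :
    c ∈ LinearMap.range (coboundary P.rho Q.rho) := by
  rw [ne_eq, Sym2.eq_iff, not_or] at hne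
  refine mem_range_coboundary_of_front hPQ h₀ fun x' y' h' => ?_
  by_cases hswap : P.blockOf x' = P.blockOf y₀ ∧ P.blockOf y' = P.blockOf x₀
  · exact (cocycle_front_eq_of_sym2_ne h' h₁ (by grind)).trans
      (cocycle_front_eq_of_sym2_ne h₁ h₀ (by grind))
  · exact cocycle_front_eq_of_sym2_ne h' h₀ hswap

theorem range_coboundary_eq_top [Finite G] (hG : (Nat.card G : k) ≠ 0)
    (hPQ : ∀ x y, ¬ P.MergesBlocks Q x y) : LinearMap.range (coboundary P.rho Q.rho) = ⊤ := by
  refine eq_top_iff.2 fun c _ => ?_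
  by_cases hle : P.IsFiner Q
  · by_cases hjoin : ∃ x y, P.Joins Q x y
    · obtain ⟨x₀, y₀, h₀⟩ := hjoin
      obtain ⟨x, y, h, hne⟩ : ∃ x y, P.Joins Q x y ∧
          s(P.blockOf x, P.blockOf y) ≠ s(P.blockOf x₀, P.blockOf y₀) := by
        by_contra! hall
        exact hPQ x₀ y₀ (mergesBlocks_of_joins hle h₀ hall)
      exact mem_range_coboundary_of_joins hle h₀ h hne
    · push Not at hjoin
      exact mem_range_coboundary_of_blockOf_eq_iff c hG fun x y =>
        ⟨hle x y, fun h => by_contra fun hne => hjoin x y ⟨h, hne⟩⟩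
  · exact mem_range_coboundary_of_not_isFiner c hle

end LabelledSetPartition

/-! ### `Ext¹` for two labelled set partitions which differ by one merge of blocks -/

namespace LabelledSetPartition

variable {k : Type u} [Field k] {G : Type v} [Group G] {n : ℕ} [NeZero n]

/-- The submonoid of the ordered `G`-partitions whose blocks are unions of blocks of `Q`: the
elements which lie above the `J`-class of `Q`. -/
def coarsenings {X : Type*} (Q : LabelledSetPartition n X) : Submonoid (OrderedGPartition n G) where
  carrier := {σ | Q.Refines σ}
  mul_mem' hσ hτ := refines_mul.2 ⟨hσ, hτ⟩
  one_mem' := refines_one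

/-- The restriction of the action on `S_P` to the elements above the `J`-class of `Q`. -/
noncomputable def rhoAbove {X : Type*} (P : LabelledSetPartition n (Irr k G))
    (Q : LabelledSetPartition n X) :
    Representation k (coarsenings (G := G) Q) (⨂[k] B : P.Block, (P.label B).rep) :=
  P.rho.comp (coarsenings Q).subtype

namespace MergesBlocks

variable {P Q : LabelledSetPartition n (Irr k G)} {x₀ y₀ : Fin n} (hPQ : P.MergesBlocks Q x₀ y₀)

include hPQ in
theorem map_rho (d : (P.rhoAbove Q).IntertwiningMap (Q.rhoAbove Q)) {σ : OrderedGPartition n G}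
    (h : σ.rank x₀ = σ.rank y₀) (z : ⨂[k] B : P.Block, (P.label B).rep) :
    d (P.rho σ z) = Q.rho σ (d z) := by
  by_cases hP : P.Refines σ
  · exact d.isIntertwining _ _ ⟨σ, hPQ.refines hP h⟩ z
  · rw [P.rho_of_not_refines hP, Q.rho_of_not_refines fun hQ => hP (hPQ.isFiner.refines hQ),
      LinearMap.zero_apply, LinearMap.zero_apply, map_zero]

/-- The cocycle which is `d ∘ P.rho σ` on those `σ` that place the block of `x₀` before that of
`y₀`, and zero on the others. -/
noncomputable def cocycleOfMap (d : (P.rhoAbove Q).IntertwiningMap (Q.rhoAbove Q)) :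
    cocycles P.rho Q.rho :=
  ⟨fun σ => if σ.rank x₀ < σ.rank y₀ then d.toLinearMap ∘ₗ P.rho σ else 0, fun σ τ z => by
    have hsep (h : σ.rank x₀ ≠ σ.rank y₀) : Q.rho σ = 0 :=
      Q.rho_of_not_refines fun hQ => h (hQ.rank_eq hPQ.joins.1)
    simp only [OrderedGPartition.rank_mul_lt_iff]
    rcases lt_trichotomy (σ.rank x₀) (σ.rank y₀) with h | h | h
    · rw [if_pos (.inl h), if_pos h, hsep h.ne, map_mul, LinearMap.zero_apply, zero_add]
      rfl
    · simp only [h, lt_irrefl, true_and, false_or, if_false, LinearMap.zero_apply, add_zero]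
      split_ifs
      · rw [map_mul]
        exact hPQ.map_rho d h (P.rho τ z)
      · rw [LinearMap.zero_apply, map_zero]
    · rw [if_neg (by lia), if_neg h.not_gt, hsep h.ne', LinearMap.zero_apply, LinearMap.zero_apply,
        LinearMap.zero_apply, add_zero]⟩

/-- The difference of the values of a cocycle at the ordered partition which places the block of
`x₀` first and at the one which places the block of `y₀` first. -/
noncomputable def frontDifference :
    cocycles P.rho Q.rho →ₗ[k] (P.rhoAbove Q).IntertwiningMap (Q.rhoAbove Q) where
  toFun c :=
    { toLinearMap := c.1 (.front (P.blockOf x₀).1 1) - c.1 (.front (P.blockOf y₀).1 1)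
      isIntertwining' := fun σ => by
        have h := cocycle_of_refines (c := c) hPQ.isFiner hPQ.joins σ.2
        rw [cocycle_of_refines hPQ.isFiner hPQ.joins.symm σ.2] at h
        change _ ∘ₗ P.rho σ.1 = Q.rho σ.1 ∘ₗ _
        rw [LinearMap.sub_comp, LinearMap.comp_sub]
        exact sub_eq_sub_iff_sub_eq_sub.1 h.symm }
  map_add' c d :=
    Representation.IntertwiningMap.toLinearMap_injective _ _ (add_sub_add_comm _ _ _ _)
  map_smul' r c := Representation.IntertwiningMap.toLinearMap_injective _ _ (smul_sub r _ _).symm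

theorem frontDifference_eq_zero_iff {c : cocycles P.rho Q.rho} : hPQ.frontDifference c = 0 ↔
    c.1 (.front (P.blockOf x₀).1 1) = c.1 (.front (P.blockOf y₀).1 1) :=
  (Representation.IntertwiningMap.toLinearMap_injective _ _).eq_iff.symm.trans sub_eq_zero

theorem frontDifference_surjective : Function.Surjective hPQ.frontDifference := fun d => by
  have hx : (OrderedGPartition.front (P.blockOf x₀).1 (1 : G)).rank x₀ <
      (OrderedGPartition.front (P.blockOf x₀).1 (1 : G)).rank y₀ := hPQ.joins.rank_front_lt 1
  have hy : ¬ (OrderedGPartition.front (P.blockOf y₀).1 (1 : G)).rank x₀ <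
      (OrderedGPartition.front (P.blockOf y₀).1 (1 : G)).rank y₀ :=
    (hPQ.joins.symm.rank_front_lt 1).not_gt
  refine ⟨hPQ.cocycleOfMap d, Representation.IntertwiningMap.toLinearMap_injective _ _ ?_⟩
  change (if _ then _ else _) - (if _ then _ else _) = _
  rw [if_pos hx, if_neg hy, sub_zero, rho_front_one]
  rfl

theorem ker_frontDifference :
    LinearMap.ker hPQ.frontDifference = LinearMap.range (coboundary P.rho Q.rho) := by
  ext c
  rw [LinearMap.mem_ker, frontDifference_eq_zero_iff]
  constructor
  · refine fun h => mem_range_coboundary_of_front hPQ.isFiner hPQ.joins fun x y hxy => ?_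
    rcases hPQ.eq_or_eq hxy with ⟨hx, -⟩ | ⟨hx, -⟩
    · rw [hx]
    · rw [hx, h]
  · rw [mem_range_coboundary_iff]
    rintro ⟨h, hh⟩
    have hfront {x y : Fin n} (hxy : P.Joins Q x y) : c.1 (.front (P.blockOf x).1 1) = -h := by
      refine LinearMap.ext fun z => ?_
      rw [hh, Q.rho_of_not_refines (hxy.not_refines_front 1), rho_front_one, LinearMap.zero_apply,
        Module.End.one_apply, zero_sub, LinearMap.neg_apply]
    rw [hfront hPQ.joins, hfront hPQ.joins.symm]

include hPQ in
theorem rank_cohomologyOne : Module.rank k (cohomologyOne P.rho Q.rho) =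
    Module.rank k ((P.rhoAbove Q).IntertwiningMap (Q.rhoAbove Q)) :=
  ((Submodule.quotEquivOfEq _ _ hPQ.ker_frontDifference.symm).trans
    (hPQ.frontDifference.quotKerEquivOfSurjective hPQ.frontDifference_surjective)).rank_eq

end MergesBlocks

end LabelledSetPartition

/-! ### Merging two blocks -/

namespace LabelledSetPartition

section Merge

variable {n : ℕ} {X : Type w} (P : LabelledSetPartition n X) (B C : P.Block) (hBC : B ≠ C) (U : X)

/-- The block `B ∪ C` of `P.merge B C hBC U`. -/
def mergeBlock : (P.merge B C hBC U).Block := ⟨B.1 ∪ C.1, U, .inl rfl⟩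

variable {B C} in
theorem mem_carrier_merge_of_ne {D : P.Block} (hD : D ≠ B ∧ D ≠ C) :
    (D.1, P.label D) ∈ (P.merge B C hBC U).carrier :=
  .inr ⟨P.label_mem D, by
    rintro (h | h)
    · exact hD.1 (Subtype.ext (congrArg Prod.fst h))
    · exact hD.2 (Subtype.ext (congrArg Prod.fst h))⟩

/-- The blocks of `P.merge B C hBC U` other than `B ∪ C`, which are blocks of `P`. -/
def mergeOther (D : {D : P.Block // D ≠ B ∧ D ≠ C}) : (P.merge B C hBC U).Block :=
  ⟨D.1.1, P.label D.1, P.mem_carrier_merge_of_ne hBC U D.2⟩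

theorem label_mergeBlock : (P.merge B C hBC U).label (P.mergeBlock B C hBC U) = U :=
  label_eq _ _ (.inl rfl)

theorem label_mergeOther (D : {D : P.Block // D ≠ B ∧ D ≠ C}) :
    (P.merge B C hBC U).label (P.mergeOther B C hBC U D) = P.label D.1 :=
  label_eq _ _ (P.mem_carrier_merge_of_ne hBC U D.2)

variable {P B C hBC U} {x y : Fin n}

theorem blockOf_merge_of_eq_or_eq (h : P.blockOf x = B ∨ P.blockOf x = C) :
    (P.merge B C hBC U).blockOf x = P.mergeBlock B C hBC U :=
  mem_block_iff.1 (Finset.mem_union.2 (h.imp mem_block_iff.2 mem_block_iff.2))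

theorem blockOf_merge_of_ne (h : P.blockOf x ≠ B ∧ P.blockOf x ≠ C) :
    (P.merge B C hBC U).blockOf x = P.mergeOther B C hBC U ⟨P.blockOf x, h⟩ :=
  mem_block_iff.1 (P.mem_blockOf x)

theorem mergeOther_ne_mergeBlock (D : {D : P.Block // D ≠ B ∧ D ≠ C}) :
    P.mergeOther B C hBC U D ≠ P.mergeBlock B C hBC U := fun h => by
  obtain ⟨x, rfl⟩ := P.blockOf_surjective B
  have h' : D.1.1 = (P.blockOf x).1 ∪ C.1 := congrArg Subtype.val h
  exact D.2.1 (mem_block_iff.1 (h' ▸ Finset.mem_union_left _ (P.mem_blockOf x))).symm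

theorem mergeOther_injective : Function.Injective (P.mergeOther B C hBC U) := fun D E h => by
  have h' : D.1.1 = E.1.1 := congrArg (fun F : (P.merge B C hBC U).Block => F.1) h
  exact Subtype.ext (Subtype.ext h')

variable (P B C hBC U) in
/-- The blocks of `P.merge B C hBC U` are `B ∪ C` and the blocks of `P` other than `B` and `C`. -/
noncomputable def mergeEquiv :
    Option {D : P.Block // D ≠ B ∧ D ≠ C} ≃ (P.merge B C hBC U).Block :=
  Equiv.ofBijective (fun o => o.elim (P.mergeBlock B C hBC U) (P.mergeOther B C hBC U)) <| by
    refine ⟨?_, fun D => ?_⟩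
    · rintro (_ | D) (_ | E) h
      · rfl
      · exact absurd h.symm (mergeOther_ne_mergeBlock E)
      · exact absurd h (mergeOther_ne_mergeBlock D)
      · exact congrArg some (mergeOther_injective h)
    · obtain ⟨x, rfl⟩ := (P.merge B C hBC U).blockOf_surjective D
      by_cases h : P.blockOf x = B ∨ P.blockOf x = C
      · exact ⟨none, (blockOf_merge_of_eq_or_eq h).symm⟩
      · exact ⟨some ⟨P.blockOf x, not_or.1 h⟩, (blockOf_merge_of_ne _).symm⟩

variable (P) in
/-- The blocks of `P` are `B`, `C` and the others. -/
noncomputable def splitOffPair (hBC : B ≠ C) :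
    Option (Option {D : P.Block // D ≠ B ∧ D ≠ C}) ≃ P.Block :=
  Equiv.ofBijective (fun o => o.elim B fun o => o.elim C Subtype.val) <| by
    refine ⟨?_, fun D => ?_⟩
    · rintro (_ | _ | D) (_ | _ | E) h
      · rfl
      · exact absurd h hBC
      · exact absurd h.symm E.2.1
      · exact absurd h.symm hBC
      · rfl
      · exact absurd h.symm E.2.2
      · exact absurd h D.2.1
      · exact absurd h D.2.2
      · exact congrArg (some ∘ some) (Subtype.ext h)
    · by_cases hB : D = B
      · exact ⟨none, hB.symm⟩
      · by_cases hC : D = C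
        · exact ⟨some none, hC.symm⟩
        · exact ⟨some (some ⟨D, hB, hC⟩), rfl⟩

theorem blockOf_merge_eq_iff : (P.merge B C hBC U).blockOf x = (P.merge B C hBC U).blockOf y ↔
    P.blockOf x = P.blockOf y ∨
      (P.blockOf x = B ∨ P.blockOf x = C) ∧ (P.blockOf y = B ∨ P.blockOf y = C) := by
  by_cases hx : P.blockOf x = B ∨ P.blockOf x = C <;>
    by_cases hy : P.blockOf y = B ∨ P.blockOf y = C
  · simp only [blockOf_merge_of_eq_or_eq, hx, hy, and_self, or_true]
  · have hne : P.blockOf x ≠ P.blockOf y := fun h => hy (h ▸ hx)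
    simp only [blockOf_merge_of_eq_or_eq hx, blockOf_merge_of_ne (not_or.1 hy), hy, hne,
      (mergeOther_ne_mergeBlock _).symm, and_false, or_self]
  · have hne : P.blockOf x ≠ P.blockOf y := fun h => hx (h ▸ hy)
    simp only [blockOf_merge_of_eq_or_eq hy, blockOf_merge_of_ne (not_or.1 hx), hx, hne,
      mergeOther_ne_mergeBlock, false_and, or_self]
  · simp only [blockOf_merge_of_ne (not_or.1 hx), blockOf_merge_of_ne (not_or.1 hy),
      mergeOther_injective.eq_iff, Subtype.mk.injEq, hx, false_and, or_false]

theorem isFiner_merge : P.IsFiner (P.merge B C hBC U) := fun _ _ h =>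
  blockOf_merge_eq_iff.2 (.inl h)

theorem mergesBlocks_merge {x₀ y₀ : Fin n} (hx : P.blockOf x₀ = B) (hy : P.blockOf y₀ = C) :
    P.MergesBlocks (P.merge B C hBC U) x₀ y₀ where
  ne := by rwa [hx, hy]
  blockOf_eq_iff x y := by
    rw [blockOf_merge_eq_iff, Sym2.eq_iff, hx, hy]
    grind

theorem MergesBlocks.eq_merge {Q : LabelledSetPartition n X} {x₀ y₀ : Fin n}
    (hPQ : P.MergesBlocks Q x₀ y₀)
    (hlabel : ∀ x, P.blockOf x ≠ P.blockOf x₀ → P.blockOf x ≠ P.blockOf y₀ →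
      P.label (P.blockOf x) = Q.label (Q.blockOf x)) :
    Q = P.merge (P.blockOf x₀) (P.blockOf y₀) hPQ.ne (Q.label (Q.blockOf x₀)) := by
  refine ext_blockOf (fun x y => (hPQ.blockOf_eq_iff x y).trans
    ((mergesBlocks_merge rfl rfl).blockOf_eq_iff x y).symm) fun x => ?_
  by_cases h : P.blockOf x = P.blockOf x₀ ∨ P.blockOf x = P.blockOf y₀
  · have hQ : Q.blockOf x = Q.blockOf x₀ :=
      h.elim (hPQ.isFiner x x₀) fun h => (hPQ.isFiner x y₀ h).trans hPQ.joins.1.symm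
    rw [blockOf_merge_of_eq_or_eq h, label_mergeBlock, hQ]
  · rw [blockOf_merge_of_ne (not_or.1 h), label_mergeOther]
    exact (hlabel x (not_or.1 h).1 (not_or.1 h).2).symm

end Merge

end LabelledSetPartition

/-! ### The number of arrows -/

namespace LabelledSetPartition

section MergeValues

variable {n : ℕ} [NeZero n] {X : Type w} (P : LabelledSetPartition n X) (B C : P.Block)
  (hBC : B ≠ C) (U : X) {G : Type v} [Group G]

/-- The elements of `G` that an ordered `G`-partition which lies above `P.merge B C hBC U` attaches
to the block `B ∪ C` and to the other blocks. -/
noncomputable def mergeValues : coarsenings (G := G) (P.merge B C hBC U) →*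
    G × ({D : P.Block // D ≠ B ∧ D ≠ C} → G) where
  toFun σ := (Refines.value σ.2 (P.mergeBlock B C hBC U),
    fun D => Refines.value σ.2 (P.mergeOther B C hBC U D))
  map_one' := Prod.ext (Refines.value_one _ _) (funext fun _ => Refines.value_one _ _)
  map_mul' σ τ := Prod.ext (Refines.value_mul _ σ.2 τ.2 _)
    (funext fun _ => Refines.value_mul _ σ.2 τ.2 _)

theorem mergeValues_surjective :
    Function.Surjective (P.mergeValues B C hBC U (G := G)) := fun ⟨g, δ⟩ => by
  let M := P.merge B C hBC U
  let E := P.mergeEquiv B C hBC U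
  let γ : M.Block → G := fun D => (E.symm D).elim g δ
  have hγ (o) : γ (E o) = o.elim g δ := congrArg (·.elim g δ) (E.symm_apply_apply o)
  exact ⟨⟨M.ordered γ, M.refines_ordered γ⟩, Prod.ext
    ((M.value_ordered γ _ _).trans (hγ none))
    (funext fun D => (M.value_ordered γ _ _).trans (hγ (some D)))⟩

end MergeValues

section MergeRank

variable {k : Type u} [Field k] {G : Type v} [Group G] {n : ℕ} [NeZero n]
  (P : LabelledSetPartition n (Irr k G)) (B C : P.Block) (hBC : B ≠ C) (U : Irr k G)

/-- The outer tensor product of the labels of the blocks of `P` other than `B` and `C`. -/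
noncomputable abbrev otherTprod : Representation k ({D : P.Block // D ≠ B ∧ D ≠ C} → G)
    (⨂[k] D : {D : P.Block // D ≠ B ∧ D ≠ C}, (P.label D.1).rep) :=
  piTprod fun D => (P.label D.1).rho

theorem exists_equiv_rhoAbove_merge :
    ∃ f : (⨂[k] D : P.Block, (P.label D).rep) ≃ₗ[k] ((P.label B).rep ⊗[k] (P.label C).rep) ⊗[k]
        (⨂[k] D : {D : P.Block // D ≠ B ∧ D ≠ C}, (P.label D.1).rep),
      ∀ (σ : coarsenings (P.merge B C hBC U)) x, f (P.rhoAbove (P.merge B C hBC U) σ x) =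
        outerTprod ((P.label B).rho.tprod (P.label C).rho) (P.otherTprod B C)
          (P.mergeValues B C hBC U σ) (f x) := by
  let E := P.splitOffPair hBC
  obtain ⟨e, he⟩ := exists_equiv_piTprod (τ := fun D => (P.label D).rho)
    (ρ := fun o => (P.label (E o)).rho) E fun o => Representation.Equiv.refl _
  obtain ⟨f, hf⟩ := exists_equiv_outerTprod_tprod fun o => (P.label (E o)).rho
  refine ⟨e.trans f, fun σ x => ?_⟩
  have hσ : P.Refines σ.1 := isFiner_merge.refines σ.2
  have values : hσ.value ∘ E = fun o => o.elim (P.mergeValues B C hBC U σ).1 fun o =>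
      o.elim (P.mergeValues B C hBC U σ).1 (P.mergeValues B C hBC U σ).2 := by
    funext o
    rcases o with _ | _ | D
    · exact hσ.value_eq_value _ Finset.subset_union_left
    · exact hσ.value_eq_value _ Finset.subset_union_right
    · exact hσ.value_eq_value _ subset_rfl
  have he' : e (P.rhoAbove (P.merge B C hBC U) σ x) =
      piTprod (fun o => (P.label (E o)).rho) (hσ.value ∘ E) (e x) := by
    rw [← he]
    exact congrArg (fun S => e (S x)) (rho_of_refines hσ)
  rw [values] at he'
  exact (congrArg f he').trans (hf _ _ _)

theorem exists_equiv_merge_rhoAbove :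
    ∃ f : (⨂[k] D : (P.merge B C hBC U).Block, ((P.merge B C hBC U).label D).rep) ≃ₗ[k]
        U.rep ⊗[k] (⨂[k] D : {D : P.Block // D ≠ B ∧ D ≠ C}, (P.label D.1).rep),
      ∀ (σ : coarsenings (P.merge B C hBC U)) x,
        f ((P.merge B C hBC U).rhoAbove (P.merge B C hBC U) σ x) =
          outerTprod U.rho (P.otherTprod B C) (P.mergeValues B C hBC U σ) (f x) := by
  let M := P.merge B C hBC U
  let E := P.mergeEquiv B C hBC U
  let V (o : Option {D : P.Block // D ≠ B ∧ D ≠ C}) : Irr k G := o.elim U fun D => P.label D.1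
  have hV : ∀ o, M.label (E o) = V o := by
    rintro (_ | D)
    · exact P.label_mergeBlock B C hBC U
    · exact P.label_mergeOther B C hBC U D
  obtain ⟨e, he⟩ := exists_equiv_piTprod (τ := fun D => (M.label D).rho) (ρ := fun o => (V o).rho)
    E fun o => hV o ▸ Representation.Equiv.refl _
  obtain ⟨f, hf⟩ := exists_equiv_outerTprod fun o => (V o).rho
  refine ⟨e.trans f, fun σ x => ?_⟩
  have he' : e (M.rhoAbove M σ x) =
      piTprod (fun o => (V o).rho) (Refines.value σ.2 ∘ E) (e x) := by
    rw [← he]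
    exact congrArg (fun S => e (S x)) (rho_of_refines σ.2)
  exact (congrArg f he').trans (hf _ _)

variable [IsAlgClosed k] [Finite G]

theorem rank_intertwiningMap_rhoAbove_merge (hG : (Nat.card G : k) ≠ 0) :
    Module.rank k ((P.rhoAbove (P.merge B C hBC U)).IntertwiningMap
      ((P.merge B C hBC U).rhoAbove (P.merge B C hBC U))) =
        dimHomTensor U (P.label B) (P.label C) := by
  let ρ := (P.label B).rho.tprod (P.label C).rho
  obtain ⟨e, he⟩ := P.exists_equiv_rhoAbove_merge B C hBC U
  obtain ⟨f, hf⟩ := P.exists_equiv_merge_rhoAbove B C hBC U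
  let restrict := (intertwiningMapEquiv (P.mergeValues_surjective B C hBC U) e he f hf).trans
    (LinearEquiv.ofBijective _ (bijective_outerTprodHom ρ U.rho (P.otherTprod B C))).symm
  calc _ = Module.rank k (ρ.IntertwiningMap U.rho) := restrict.rank_eq
    _ = Module.rank k (U.rho.IntertwiningMap ρ) := by
      rw [← Module.finrank_eq_rank, ← Module.finrank_eq_rank, finrank_intertwiningMap_comm hG]

end MergeRank

section Arrows

variable {k : Type u} [Field k] {G : Type v} [Group G] {n : ℕ} [NeZero n]
  {P Q : LabelledSetPartition n (Irr k G)}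
  {S T : SimpleClass (MonoidAlgebra k (OrderedGPartition n G))}

theorem gabrielArrows_merge [IsAlgClosed k] [Finite G] (hG : (Nat.card G : k) ≠ 0)
    {B C : P.Block} {hBC : B ≠ C} {U : Irr k G}
    (e : S.rep ≃ₗ[MonoidAlgebra k (OrderedGPartition n G)] P.rho.asModule)
    (f : T.rep ≃ₗ[MonoidAlgebra k (OrderedGPartition n G)] (P.merge B C hBC U).rho.asModule) :
    gabrielArrows k (MonoidAlgebra k (OrderedGPartition n G)) S T =
      dimHomTensor U (P.label B) (P.label C) := by
  obtain ⟨x₀, hx⟩ := P.blockOf_surjective B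
  obtain ⟨y₀, hy⟩ := P.blockOf_surjective C
  rw [gabrielArrows_eq_rank_cohomologyOne e f, (mergesBlocks_merge hx hy).rank_cohomologyOne,
    P.rank_intertwiningMap_rhoAbove_merge B C hBC U hG]

theorem MergesBlocks.rank_cohomologyOne_eq_zero {x₀ y₀ x : Fin n} (hPQ : P.MergesBlocks Q x₀ y₀)
    (hx : P.blockOf x ≠ P.blockOf x₀) (hy : P.blockOf x ≠ P.blockOf y₀)
    (hne : P.label (P.blockOf x) ≠ Q.label (Q.blockOf x)) :
    Module.rank k (cohomologyOne P.rho Q.rho) = 0 := by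
  have hBC := hPQ.blockOf_val_eq hx hy
  have hom_eq_zero (d : (P.rhoAbove Q).IntertwiningMap (Q.rhoAbove Q)) : d.toLinearMap = 0 :=
    hom_eq_zero_of_label_ne hBC hne fun g z =>
      d.isIntertwining _ _ ⟨.front (P.blockOf x).1 g, hBC ▸ refines_front _ g⟩ z
  have : Subsingleton ((P.rhoAbove Q).IntertwiningMap (Q.rhoAbove Q)) :=
    ⟨fun d d' => Representation.IntertwiningMap.ext ((hom_eq_zero d).trans (hom_eq_zero d').symm)⟩
  rw [hPQ.rank_cohomologyOne, rank_subsingleton']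

theorem gabrielArrows_eq_zero_of_ne_merge [Finite G] (hG : (Nat.card G : k) ≠ 0)
    (hne : ¬ ∃ (B C : P.Block) (hBC : B ≠ C) (U : Irr k G), Q = P.merge B C hBC U)
    (e : S.rep ≃ₗ[MonoidAlgebra k (OrderedGPartition n G)] P.rho.asModule)
    (f : T.rep ≃ₗ[MonoidAlgebra k (OrderedGPartition n G)] Q.rho.asModule) :
    gabrielArrows k (MonoidAlgebra k (OrderedGPartition n G)) S T = 0 := by
  by_cases hPQ : ∃ x₀ y₀, P.MergesBlocks Q x₀ y₀
  · obtain ⟨x₀, y₀, hPQ⟩ := hPQ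
    obtain ⟨x, hx, hy, hlabel⟩ : ∃ x, P.blockOf x ≠ P.blockOf x₀ ∧ P.blockOf x ≠ P.blockOf y₀ ∧
        P.label (P.blockOf x) ≠ Q.label (Q.blockOf x) := by
      by_contra! h
      exact hne ⟨_, _, _, _, hPQ.eq_merge h⟩
    rw [gabrielArrows_eq_rank_cohomologyOne e f, hPQ.rank_cohomologyOne_eq_zero hx hy hlabel]
  · push Not at hPQ
    exact gabrielArrows_eq_zero e f (range_coboundary_eq_top hG hPQ)

end Arrows

end LabelledSetPartition

theorem theorem6p3 (k : Type u) [Field k] [IsAlgClosed k] (G : Type v) [Group G] [Finite G]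
    (hchar : ¬ ringChar k ∣ Nat.card G) (n : ℕ) [NeZero n] :
    ∃ Φ : LabelledSetPartition n (Irr k G) ≃
        SimpleClass (MonoidAlgebra k (OrderedGPartition n G)),
      (∀ P : LabelledSetPartition n (Irr k G),
        Nonempty ((Φ P).rep ≃ₗ[MonoidAlgebra k (OrderedGPartition n G)] P.action.asModule)) ∧
      (∀ (P : LabelledSetPartition n (Irr k G)) (B C : P.Block) (hBC : B ≠ C) (U : Irr k G),
        gabrielArrows k (MonoidAlgebra k (OrderedGPartition n G)) (Φ P) (Φ (P.merge B C hBC U)) =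
          dimHomTensor U (P.label B) (P.label C)) ∧
      (∀ P Q : LabelledSetPartition n (Irr k G),
        (¬ ∃ (B C : P.Block) (hBC : B ≠ C) (U : Irr k G), Q = P.merge B C hBC U) →
        gabrielArrows k (MonoidAlgebra k (OrderedGPartition n G)) (Φ P) (Φ Q) = 0) := by
  have hG : (Nat.card G : k) ≠ 0 := fun h => hchar ((ringChar.spec k _).1 h)
  have simple_equiv (P : LabelledSetPartition n (Irr k G)) :
      Nonempty (P.simple.rep ≃ₗ[MonoidAlgebra k (OrderedGPartition n G)] P.rho.asModule) :=
    (P.simple.nonempty_linearEquiv_iff P.rho).2 P.nonempty_simple_rho_equiv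
  refine ⟨.ofBijective _ (LabelledSetPartition.bijective_simple hG), simple_equiv,
    fun P B C hBC U => ?_, fun P Q hne => ?_⟩
  · obtain ⟨e⟩ := simple_equiv P
    obtain ⟨f⟩ := simple_equiv (P.merge B C hBC U)
    exact LabelledSetPartition.gabrielArrows_merge hG e f
  · obtain ⟨e⟩ := simple_equiv P
    obtain ⟨f⟩ := simple_equiv Q
    exact LabelledSetPartition.gabrielArrows_eq_zero_of_ne_merge hG hne e f
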